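/- Let $\rho:[0,1]\to(0,\infty)$ be a continuously differentiable probability density and let $B\ge 2$ be an integer (one item, $B$ bidders with values distributed according to $d\mu=\rho\,dx$). Put $\mathcal P(x)=\int_0^x\rho(s)\,ds$, $\mathcal Q=\mathcal P^{-1}:[0,1]\to[0,1]$, $V(x)=x-\frac{1-\mathcal P(x)}{\rho(x)}$. For a function $v$ on $[0,1]$ let $G_v(t)=\int_{\mathcal Q(t)}^1 v(x)\rho(x)\,dx$, and for a finite positive Borel measure $\varsigma$ on $[0,1]$ let $G_\varsigma(t)=\varsigma([\mathcal Q(t),1])$, $t\in[0,1]$. Let $\overline{G_V}$ be the pointwise infimum of all non-negative, non-increasing, concave functions on $[0,1]$ lying above $G_V$, and let $\overline V(x)=-\overline{G_V}\,'(\mathcal P(x))$ be the (Myersonian) ironed virtual valuation. Dual problem. A finite positive Borel measure $\varsigma$ on $[0,1]$ is feasible if $\int_0^1(xu'(x)-u(x))\rho(x)\,dx\le\int u'\,d\varsigma$ for every smooth non-decreasing convex $u:[0,1]\to\mathbb R$ with $u(0)=0$. Write $d\varsigma=\varsigma^a\rho\,dx+d\varsigma^{\mathrm{sing}}$ for its Lebesgue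 decomposition with respect to $\mu$. A function $\varphi:[0,\infty)\to[0,\infty]$ is admissible if it is convex and non-decreasing with $\varphi(0)=0$; let $\varphi^*(y)=\sup_{x\ge0}(xy-\varphi(x))$. The objective is $$J(\varsigma,\varphi)=\varsigma^{\mathrm{sing}}([0,1])+\int_0^1\varphi^*(\varsigma^a(x))\rho(x)\,dx+\int_0^1\varphi(t^{B-1})\,dt .$$ The measure $\varsigma$ solves the dual problem if it is feasible and minimizes $\mathrm{Dual}(\varsigma)=\inf_\varphi J(\varsigma,\varphi)$ over the feasible measures; $(\varsigma,\varphi)$ is an optimal pair if it minimizes $J$ over all pairs of a feasible measure and an admissible function. Then: (1) $\overline{G_V}$ is itself non-negative, non-increasing, concave and $\ge G_V$; for almost every $x\in[0,1]$ it is differentiable at $\mathcal P(x)$ and $\overline V(x)\ge0$; and $\overline{G_V}=G_{\overline V}$ on $[0,1]$. (2) For a finite positive Borel measure $\varsigma$ on $[0,1]$ the following are equivalent: $\varsigma$ solves the dual problem; $G_\varsigma=G_{\overline V}$ on $[0,1]$; $d\varsigma=\overline V\rho\,dx$. (3) The dual problem has exactly one solution $\varsigma$; it has no singular part, and its density is $\varsigma^a=\overline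 V$ almost everywhere. That is, the optimal vector field is the ironed virtual valuation. (4) $(\varsigma,\varphi)$ is an optimal pair if and only if $\varsigma$ solves the dual problem, $\varphi$ is admissible, and $\overline V(x)\in\partial\varphi(\mathcal P(x)^{B-1})$ for almost every $x\in[0,1]$. (5) The optimal $\varphi$ is unique: the functions $\varphi$ of any two optimal pairs coincide on $[0,1)$, and there is exactly one optimal pair $(\varsigma,\varphi)$ in which $\varphi$ is lower semicontinuous and equal to $+\infty$ on $(1,\infty)$. -/

import Mathlib

open Set MeasureTheory
open scoped NNReal ENNReal ContDiff

noncomputable section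

namespace OneItem

/-! ### The distribution of values and virtual valuations -/

/-- The distribution `ρ(x) dx` of a bidder's value, a measure concentrated on `[0,1]`. -/
def valueDist (ρ : ℝ → ℝ) : Measure ℝ :=
  (volume.restrict (Icc 0 1)).withDensity fun x => ENNReal.ofReal (ρ x)

/-- The cumulative distribution function `P(x) = ∫₀ˣ ρ`. -/
def distFun (ρ : ℝ → ℝ) (x : ℝ) : ℝ := ∫ s in (0 : ℝ)..x, ρ s

/-- The quantile function: the inverse of `P` as a map from `[0,1]` to `[0,1]`. -/
def quantile (ρ : ℝ → ℝ) : ℝ → ℝ := Function.invFunOn (distFun ρ) (Icc 0 1)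

/-- The virtual valuation `V(x) = x - (1 - P(x)) / ρ(x)`. -/
def virtualValue (ρ : ℝ → ℝ) (x : ℝ) : ℝ := x - (1 - distFun ρ x) / ρ x

/-- For a function `v` on `[0,1]`, the function `G_v(t) = ∫_{Q(t)}^1 v(x) ρ(x) dx`, `t ∈ [0,1]`. -/
def curve (ρ v : ℝ → ℝ) (t : ℝ) : ℝ := ∫ x in quantile ρ t..1, v x * ρ x

/-- For a finite measure `ς` on `[0,1]`, the function `G_ς(t) = ς([Q(t),1])`, `t ∈ [0,1]`. -/
def measureCurve (ρ : ℝ → ℝ) (ς : Measure ℝ) (t : ℝ) : ℝ := ς.real (Icc (quantile ρ t) 1)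

/-- `g` is a non-negative, non-increasing, concave function on `[0,1]` that lies above `G`. -/
structure IsMajorant (G g : ℝ → ℝ) : Prop where
  concave : ConcaveOn ℝ (Icc 0 1) g
  antitone : AntitoneOn g (Icc 0 1)
  nonneg : ∀ t ∈ Icc (0 : ℝ) 1, 0 ≤ g t
  le : ∀ t ∈ Icc (0 : ℝ) 1, G t ≤ g t

/-- The non-negative non-increasing concave envelope of `G` on `[0,1]`: the pointwise infimum of all
non-negative non-increasing concave functions above `G`. -/
def envelope (G : ℝ → ℝ) (t : ℝ) : ℝ := sInf {y | ∃ g, IsMajorant G g ∧ y = g t}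

/-- The concave envelope of `G_V`, where `V` is the virtual valuation. -/
def ironedCurve (ρ : ℝ → ℝ) : ℝ → ℝ := envelope (curve ρ (virtualValue ρ))

/-- The ironed virtual valuation: minus the derivative of the concave envelope of `G_V`, taken at
`P(x)`. It is determined for almost all `x ∈ [0,1]`. -/
def ironedValue (ρ : ℝ → ℝ) (x : ℝ) : ℝ := -deriv (ironedCurve ρ) (distFun ρ x)

/-! ### The dual problem -/

/-- `ς` is a (finite, non-negative, Borel) measure on `[0,1]`. -/
def IsMeasureOnUnit (ς : Measure ℝ) : Prop := IsFiniteMeasure ς ∧ ς (Icc 0 1)ᶜ = 0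

/-- The smooth non-decreasing convex functions `u` on `[0,1]` with `u(0) = 0`. -/
structure IsTest (u : ℝ → ℝ) : Prop where
  smooth : ContDiffOn ℝ ∞ u (Icc 0 1)
  convex : ConvexOn ℝ (Icc 0 1) u
  monotone : MonotoneOn u (Icc 0 1)
  zero : u 0 = 0

/-- `ς` is feasible in the dual problem: it is a measure on `[0,1]` and
`∫ (x u'(x) - u(x)) ρ(x) dx ≤ ∫ u' dς` for every test function `u`. -/
def IsFeasible (ρ : ℝ → ℝ) (ς : Measure ℝ) : Prop :=
  IsMeasureOnUnit ς ∧ ∀ u : ℝ → ℝ, IsTest u →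
    ∫ x in Icc (0 : ℝ) 1, (x * derivWithin u (Icc 0 1) x - u x) * ρ x
      ≤ ∫ x in Icc (0 : ℝ) 1, derivWithin u (Icc 0 1) x ∂ς

/-- The functions `φ` allowed in the dual problem: convex non-decreasing functions from `[0,∞)` to
`[0,∞]` with `φ(0) = 0`. -/
structure IsAdmissible (φ : ℝ≥0 → ℝ≥0∞) : Prop where
  convex : ConvexOn ℝ≥0 univ φ
  monotone : Monotone φ
  zero : φ 0 = 0

/-- The Legendre transform `φ*(y) = sup_{x ≥ 0} (x y - φ(x))` at `y ≥ 0`. Subtraction is truncated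
at `0`, which does not change the supremum, as `φ(0) = 0` and so `x = 0` contributes `0`. -/
def legendre (φ : ℝ≥0 → ℝ≥0∞) (y : ℝ≥0∞) : ℝ≥0∞ := ⨆ x : ℝ≥0, ((x : ℝ≥0∞) * y - φ x)

/-- `y ∈ ∂φ(w)`, that is, `φ(w)` is finite and `φ(z) ≥ φ(w) + y (z - w)` for all `z ≥ 0`. -/
def IsSubgradient (φ : ℝ≥0 → ℝ≥0∞) (w y : ℝ≥0) : Prop :=
  φ w ≠ ⊤ ∧ ∀ z : ℝ≥0, φ w + y * z ≤ φ z + y * w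

/-- The objective `ς^sing([0,1]) + ∫ φ*(ς^a(x)) ρ(x) dx + ∫₀¹ φ(t^(B-1)) dt`, where
`ς = ς^a(x) ρ(x) dx + ς^sing` is the Lebesgue decomposition with respect to `ρ(x) dx`. -/
def objective (ρ : ℝ → ℝ) (B : ℕ) (ς : Measure ℝ) (φ : ℝ≥0 → ℝ≥0∞) : ℝ≥0∞ :=
  ς.singularPart (valueDist ρ) (Icc 0 1)
    + ∫⁻ x, legendre φ (ς.rnDeriv (valueDist ρ) x) ∂(valueDist ρ)
    + ∫⁻ t in Icc (0 : ℝ) 1, φ (t.toNNReal ^ (B - 1))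

/-- `Dual(ς)`: the infimum of the objective over all admissible `φ`. -/
def dualValue (ρ : ℝ → ℝ) (B : ℕ) (ς : Measure ℝ) : ℝ≥0∞ :=
  ⨅ (φ : ℝ≥0 → ℝ≥0∞) (_ : IsAdmissible φ), objective ρ B ς φ

/-- `ς` solves the dual problem: it minimizes `Dual` among all feasible measures. -/
def SolvesDual (ρ : ℝ → ℝ) (B : ℕ) (ς : Measure ℝ) : Prop :=
  IsFeasible ρ ς ∧ ∀ ς' : Measure ℝ, IsFeasible ρ ς' → dualValue ρ B ς ≤ dualValue ρ B ς'

/-- `(ς, φ)` minimizes the objective among all pairs of a feasible measure and an admissible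
function. -/
def IsOptimalPair (ρ : ℝ → ℝ) (B : ℕ) (ς : Measure ℝ) (φ : ℝ≥0 → ℝ≥0∞) : Prop :=
  IsFeasible ρ ς ∧ IsAdmissible φ ∧
    ∀ (ς' : Measure ℝ) (φ' : ℝ≥0 → ℝ≥0∞), IsFeasible ρ ς' → IsAdmissible φ' →
      objective ρ B ς φ ≤ objective ρ B ς' φ'

end OneItem

end

namespace OneItem

open Filter Topology

/-! Feasibility is a bound on tails. Writing `x u' - u` and `u' - u'(0)` as integrals of `u''` and
using Tonelli, or conversely testing with smoothed ramps, it becomes `ς([a,1]) ≥ a (1 - P(a))` for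
all `a` (`isFeasible_of_le`, `le_of_isFeasible`). Since `V ρ = -(x (1 - P))'`, the right-hand side
is `G_V(P(a))`.

Put `m = B - 1`, let `S` be the singular mass and `q` the non-decreasing rearrangement of `ς^a` on
`[0,1]`. Rearranging preserves `∫ φ*(ς^a) dμ`, so Young's inequality at `s^m` gives `J ≥ S + ∫ q(s)
s^m ds = ∫ m a^(m-1) (S + ∫_a^1 q) da`. The bracket dominates the envelope: feasibility makes each
line `t ↦ S + λ (1 - t) + ∫ (ς^a - λ)₊ dμ` a majorant of `G_V`, and for `λ = q(a)` its value at `a`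
is at most the bracket (`ofReal_ironedCurve_le_quantileFun`). The resulting bound `minValue` depends
on neither `ς` nor `φ`.

It is attained by the ironed measure, whose rearranged density is the rate of decrease `k` of the
envelope, together with a `φ` that has subgradient `k(s)` at `s^m`; such a `φ` is written down as a
conjugate (`isSubgradient_optimalPhi`).

For uniqueness of the measure, equality forces `S + ∫_a^1 q` to be the envelope at almost every `a`;
letting `a → 1` kills `S`, and then `q = k`. So `ς^a` and the ironed value have the same law. To see
that they are the same function, note that the ironed value minimizes every truncated mean `∫ (f -
λ)₊ dμ` among densities satisfying the tail bound. The midpoint of two such minimizers satisfies the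
bound too, so convexity must be an equality at every rational `λ`, which forces the two to agree
(`ae_eq_ironedValue`).

With the measure fixed, `φ` is optimal exactly when Young's inequality is an equality almost
everywhere, which is the subgradient condition. It prescribes the derivative of `t ↦ φ(t^m)`, which
is Lipschitz on compact parts of `[0,1)` and vanishes at `0`; hence `φ` is determined there
(`HasAESubgradient.eq_of_lt_one`). -/

/-- `ρ` is a continuous positive probability density on `[0,1]`. -/
structure IsDensity (ρ : ℝ → ℝ) : Prop where
  continuousOn : ContinuousOn ρ (Icc 0 1)
  pos : ∀ x ∈ Icc (0 : ℝ) 1, 0 < ρ x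
  integral_eq_one : ∫ x in (0 : ℝ)..1, ρ x = 1

/-! ### The distribution function, quantiles and change of variables -/

namespace IsDensity

variable {ρ : ℝ → ℝ}

theorem intervalIntegrable (h : IsDensity ρ) {a b : ℝ} (ha : a ∈ Icc (0 : ℝ) 1)
    (hb : b ∈ Icc (0 : ℝ) 1) : IntervalIntegrable ρ volume a b :=
  (h.continuousOn.mono (uIcc_subset_Icc ha hb)).intervalIntegrable

theorem distFun_sub (h : IsDensity ρ) {a b : ℝ} (ha : a ∈ Icc (0 : ℝ) 1)
    (hb : b ∈ Icc (0 : ℝ) 1) : distFun ρ b - distFun ρ a = ∫ x in a..b, ρ x :=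
  intervalIntegral.integral_interval_sub_left
    (h.intervalIntegrable (by simp) hb) (h.intervalIntegrable (by simp) ha)

theorem distFun_zero : distFun ρ 0 = 0 := by simp [distFun]

theorem distFun_one (h : IsDensity ρ) : distFun ρ 1 = 1 := h.integral_eq_one

theorem strictMonoOn (h : IsDensity ρ) : StrictMonoOn (distFun ρ) (Icc 0 1) := by
  intro a ha b hb hab
  rw [← sub_pos, h.distFun_sub ha hb]
  exact intervalIntegral.intervalIntegral_pos_of_pos_on (h.intervalIntegrable ha hb)
    (fun x hx => h.pos x ⟨ha.1.trans hx.1.le, hx.2.le.trans hb.2⟩) hab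

theorem continuousOn_distFun (h : IsDensity ρ) : ContinuousOn (distFun ρ) (Icc 0 1) := by
  have := intervalIntegral.continuousOn_primitive_interval
    (f := ρ) (a := 0) (b := 1) (μ := volume)
    (by rw [uIcc_of_le zero_le_one]; exact h.continuousOn.integrableOn_Icc)
  rwa [uIcc_of_le zero_le_one] at this

theorem hasDerivAt_distFun (h : IsDensity ρ) {x : ℝ} (hx : x ∈ Ioo (0 : ℝ) 1) :
    HasDerivAt (distFun ρ) (ρ x) x := by
  have hnhds : Icc (0 : ℝ) 1 ∈ 𝓝 x := Icc_mem_nhds hx.1 hx.2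
  refine intervalIntegral.integral_hasDerivAt_right
    (h.intervalIntegrable (by simp) (Ioo_subset_Icc_self hx)) ?_
    (h.continuousOn.continuousAt hnhds)
  exact (h.continuousOn.mono Ioo_subset_Icc_self).stronglyMeasurableAtFilter isOpen_Ioo x hx

theorem bijOn (h : IsDensity ρ) : BijOn (distFun ρ) (Icc 0 1) (Icc 0 1) := by
  refine ⟨fun x hx => ⟨?_, ?_⟩, h.strictMonoOn.injOn, ?_⟩
  · simpa [distFun_zero] using h.strictMonoOn.monotoneOn (by simp) hx hx.1
  · simpa [h.distFun_one] using h.strictMonoOn.monotoneOn hx (by simp) hx.2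
  · have := intermediate_value_Icc zero_le_one h.continuousOn_distFun
    rwa [distFun_zero, h.distFun_one] at this

theorem distFun_mem (h : IsDensity ρ) {x : ℝ} (hx : x ∈ Icc (0 : ℝ) 1) :
    distFun ρ x ∈ Icc (0 : ℝ) 1 := h.bijOn.mapsTo hx

theorem quantile_mem (h : IsDensity ρ) {t : ℝ} (ht : t ∈ Icc (0 : ℝ) 1) :
    quantile ρ t ∈ Icc (0 : ℝ) 1 := Function.invFunOn_mem (h.bijOn.surjOn ht)

theorem distFun_quantile (h : IsDensity ρ) {t : ℝ} (ht : t ∈ Icc (0 : ℝ) 1) :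
    distFun ρ (quantile ρ t) = t := Function.invFunOn_eq (h.bijOn.surjOn ht)

theorem quantile_distFun (h : IsDensity ρ) {x : ℝ} (hx : x ∈ Icc (0 : ℝ) 1) :
    quantile ρ (distFun ρ x) = x :=
  h.bijOn.injOn (h.quantile_mem (h.distFun_mem hx)) hx (h.distFun_quantile (h.distFun_mem hx))

theorem quantile_le_iff (h : IsDensity ρ) {t x : ℝ} (ht : t ∈ Icc (0 : ℝ) 1)
    (hx : x ∈ Icc (0 : ℝ) 1) : quantile ρ t ≤ x ↔ t ≤ distFun ρ x := by
  rw [← h.strictMonoOn.le_iff_le (h.quantile_mem ht) hx, h.distFun_quantile ht]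

theorem aemeasurable (h : IsDensity ρ) :
    AEMeasurable (fun x => ENNReal.ofReal (ρ x)) (volume.restrict (Icc 0 1)) :=
  (h.continuousOn.aemeasurable measurableSet_Icc).ennreal_ofReal

theorem absolutelyContinuous : valueDist ρ ≪ volume.restrict (Icc 0 1) :=
  withDensity_absolutelyContinuous _ _

theorem ae_mem (ρ : ℝ → ℝ) : ∀ᵐ x ∂(valueDist ρ), x ∈ Icc (0 : ℝ) 1 :=
  absolutelyContinuous.ae_le (ae_restrict_mem measurableSet_Icc)

theorem integral_valueDist (h : IsDensity ρ) (g : ℝ → ℝ) :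
    ∫ x, g x ∂(valueDist ρ) = ∫ x in Icc (0 : ℝ) 1, g x * ρ x := by
  rw [valueDist, integral_withDensity_eq_integral_toReal_smul₀ h.aemeasurable (by simp)]
  refine setIntegral_congr_fun measurableSet_Icc fun x hx => ?_
  simp [ENNReal.toReal_ofReal (h.pos x hx).le, mul_comm]

theorem setIntegral_valueDist (h : IsDensity ρ) (g : ℝ → ℝ) {a : ℝ} (ha : a ∈ Icc (0 : ℝ) 1) :
    ∫ x in Icc a 1, g x ∂(valueDist ρ) = ∫ x in a..1, g x * ρ x := by
  rw [← integral_indicator measurableSet_Icc, h.integral_valueDist,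
    intervalIntegral.integral_of_le ha.2, ← integral_Icc_eq_integral_Ioc]
  have : ∀ x, (Icc a 1).indicator g x * ρ x = (Icc a 1).indicator (fun x => g x * ρ x) x := by
    intro x
    by_cases hx : x ∈ Icc a 1 <;> simp [hx]
  simp_rw [this]
  rw [setIntegral_indicator measurableSet_Icc,
    inter_eq_self_of_subset_right (Icc_subset_Icc_left ha.1)]

theorem valueDist_Icc (h : IsDensity ρ) {a b : ℝ} (ha : a ∈ Icc (0 : ℝ) 1)
    (hb : b ∈ Icc (0 : ℝ) 1) (hab : a ≤ b) :
    valueDist ρ (Icc a b) = ENNReal.ofReal (distFun ρ b - distFun ρ a) := by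
  have hsub : Icc a b ⊆ Icc 0 1 := Icc_subset_Icc ha.1 hb.2
  rw [h.distFun_sub ha hb, valueDist, withDensity_apply _ measurableSet_Icc,
    Measure.restrict_restrict measurableSet_Icc, inter_eq_self_of_subset_left hsub,
    intervalIntegral.integral_of_le hab, ← integral_Icc_eq_integral_Ioc,
    ofReal_integral_eq_lintegral_ofReal (h.continuousOn.mono hsub).integrableOn_Icc]
  exact (ae_restrict_iff' measurableSet_Icc).2 (.of_forall fun x hx => (h.pos x (hsub hx)).le)

theorem valueDist_inter (ρ : ℝ → ℝ) (s : Set ℝ) :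
    valueDist ρ (s ∩ Icc 0 1) = valueDist ρ s :=
  measure_congr (by filter_upwards [ae_mem ρ] with x hx; exact propext (and_iff_left hx))

theorem isProbabilityMeasure (h : IsDensity ρ) : IsProbabilityMeasure (valueDist ρ) := by
  constructor
  rw [← valueDist_inter, univ_inter, h.valueDist_Icc (by simp) (by simp) zero_le_one,
    h.distFun_one, distFun_zero]
  simp

theorem aemeasurable_distFun (h : IsDensity ρ) : AEMeasurable (distFun ρ) (valueDist ρ) :=
  (h.continuousOn_distFun.aemeasurable measurableSet_Icc).mono_ac absolutelyContinuous

theorem valueDist_setOf_distFun_le (h : IsDensity ρ) (t : ℝ) :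
    valueDist ρ (distFun ρ ⁻¹' Iic t) = volume.restrict (Icc 0 1) (Iic t) := by
  rw [Measure.restrict_apply measurableSet_Iic, ← valueDist_inter]
  rcases lt_or_ge t 0 with ht | ht
  · have h1 : distFun ρ ⁻¹' Iic t ∩ Icc 0 1 = ∅ := by
      ext x; simp only [mem_inter_iff, mem_preimage, mem_Iic, mem_empty_iff_false, iff_false]
      rintro ⟨h2, h3⟩
      linarith [(h.distFun_mem h3).1]
    have h2 : Iic t ∩ Icc (0 : ℝ) 1 = ∅ := by
      ext x; simp only [mem_inter_iff, mem_Iic, mem_Icc, mem_empty_iff_false, iff_false]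
      rintro ⟨h2, h3, -⟩; linarith
    simp [h1, h2]
  rcases le_or_gt t 1 with ht1 | ht1
  · have h1 : distFun ρ ⁻¹' Iic t ∩ Icc 0 1 = Icc 0 (quantile ρ t) := by
      ext x
      simp only [mem_inter_iff, mem_preimage, mem_Iic, mem_Icc]
      constructor
      · rintro ⟨h2, h3⟩
        refine ⟨h3.1, ?_⟩
        rw [← h.distFun_quantile ⟨ht, ht1⟩] at h2
        exact (h.strictMonoOn.le_iff_le h3 (h.quantile_mem ⟨ht, ht1⟩)).1 h2
      · rintro ⟨h2, h3⟩
        have hx : x ∈ Icc (0 : ℝ) 1 := ⟨h2, h3.trans (h.quantile_mem ⟨ht, ht1⟩).2⟩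
        refine ⟨?_, hx⟩
        rw [← h.distFun_quantile ⟨ht, ht1⟩]
        exact h.strictMonoOn.monotoneOn hx (h.quantile_mem ⟨ht, ht1⟩) h3
    have h2 : Iic t ∩ Icc (0 : ℝ) 1 = Icc 0 t := by
      ext x; simp only [mem_inter_iff, mem_Iic, mem_Icc]
      constructor
      · rintro ⟨h2, h3, -⟩; exact ⟨h3, h2⟩
      · rintro ⟨h2, h3⟩; exact ⟨h3, h2, h3.trans ht1⟩
    rw [h1, h2, h.valueDist_Icc (by simp) (h.quantile_mem ⟨ht, ht1⟩)
      (h.quantile_mem ⟨ht, ht1⟩).1, h.distFun_quantile ⟨ht, ht1⟩, distFun_zero]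
    simp
  · have h1 : distFun ρ ⁻¹' Iic t ∩ Icc 0 1 = Icc 0 1 :=
      inter_eq_self_of_subset_right fun x hx => (h.distFun_mem hx).2.trans ht1.le
    have h2 : Iic t ∩ Icc (0 : ℝ) 1 = Icc 0 1 :=
      inter_eq_self_of_subset_right fun x hx => hx.2.trans ht1.le
    rw [h1, h2, h.valueDist_Icc (by simp) (by simp) zero_le_one, h.distFun_one, distFun_zero]
    simp

/-- The probability integral transform: the quantile `P(x)` of a random value is uniform. All
passages between values and quantiles rest on it. -/
theorem map_distFun (h : IsDensity ρ) :
    (valueDist ρ).map (distFun ρ) = volume.restrict (Icc 0 1) := by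
  have := h.isProbabilityMeasure
  have : IsFiniteMeasure ((valueDist ρ).map (distFun ρ)) :=
    Measure.isFiniteMeasure_map _ _
  refine Measure.ext_of_Iic _ _ fun t => ?_
  rw [Measure.map_apply_of_aemeasurable h.aemeasurable_distFun measurableSet_Iic,
    h.valueDist_setOf_distFun_le]

theorem ae_distFun (h : IsDensity ρ) {p : ℝ → Prop}
    (hp : ∀ᵐ t ∂(volume.restrict (Icc (0 : ℝ) 1)), p t) :
    ∀ᵐ x ∂(valueDist ρ), p (distFun ρ x) := by
  rw [← h.map_distFun] at hp
  exact ae_of_ae_map h.aemeasurable_distFun hp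

theorem lintegral_distFun (h : IsDensity ρ) {g : ℝ → ℝ≥0∞} (hg : Measurable g) :
    ∫⁻ x, g (distFun ρ x) ∂(valueDist ρ) = ∫⁻ t in Icc (0 : ℝ) 1, g t := by
  rw [← h.map_distFun, lintegral_map' hg.aemeasurable h.aemeasurable_distFun]

theorem integral_distFun (h : IsDensity ρ) {g : ℝ → ℝ} (hg : Measurable g) {t : ℝ}
    (ht : t ∈ Icc (0 : ℝ) 1) :
    ∫ x in quantile ρ t..1, g (distFun ρ x) * ρ x = ∫ s in t..1, g s := by
  rw [← h.setIntegral_valueDist (fun x => g (distFun ρ x)) (h.quantile_mem ht),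
    ← integral_indicator measurableSet_Icc, intervalIntegral.integral_of_le ht.2,
    ← integral_Icc_eq_integral_Ioc]
  have h1 : ∫ s in Icc t 1, g s = ∫ s in Icc (0 : ℝ) 1, (Icc t 1).indicator g s := by
    rw [setIntegral_indicator measurableSet_Icc,
      inter_eq_self_of_subset_right (Icc_subset_Icc_left ht.1)]
  rw [h1, ← h.map_distFun, integral_map h.aemeasurable_distFun
    (hg.indicator measurableSet_Icc).aestronglyMeasurable]
  refine integral_congr_ae ?_
  filter_upwards [ae_mem ρ] with x hx
  have : x ∈ Icc (quantile ρ t) 1 ↔ distFun ρ x ∈ Icc t 1 := by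
    simp only [mem_Icc, h.quantile_le_iff ht hx, hx.2, (h.distFun_mem hx).2]
  by_cases hx' : x ∈ Icc (quantile ρ t) 1
  · rw [indicator_of_mem hx', indicator_of_mem (this.1 hx')]
  · rw [indicator_of_notMem hx', indicator_of_notMem (mt this.2 hx')]

theorem setLIntegral_distFun (h : IsDensity ρ) {g : ℝ → ℝ≥0∞} (hg : Measurable g) {a : ℝ}
    (ha : a ∈ Icc (0 : ℝ) 1) :
    ∫⁻ x in Icc a 1, g (distFun ρ x) ∂(valueDist ρ) = ∫⁻ s in Icc (distFun ρ a) 1, g s := by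
  rw [← lintegral_indicator measurableSet_Icc]
  have h1 : ∫⁻ s in Icc (distFun ρ a) 1, g s
      = ∫⁻ s in Icc (0 : ℝ) 1, (Icc (distFun ρ a) 1).indicator g s := by
    rw [setLIntegral_indicator measurableSet_Icc,
      inter_eq_self_of_subset_left (Icc_subset_Icc_left (h.distFun_mem ha).1)]
  rw [h1, ← h.lintegral_distFun (hg.indicator measurableSet_Icc)]
  refine lintegral_congr_ae ?_
  filter_upwards [ae_mem ρ] with x hx
  have : x ∈ Icc a 1 ↔ distFun ρ x ∈ Icc (distFun ρ a) 1 := by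
    simp only [mem_Icc, h.strictMonoOn.le_iff_le ha hx, hx.2, (h.distFun_mem hx).2]
  by_cases hx' : x ∈ Icc a 1
  · rw [indicator_of_mem hx', indicator_of_mem (this.1 hx')]
  · rw [indicator_of_notMem hx', indicator_of_notMem (mt this.2 hx')]

/-- `V ρ = x ρ - (1 - P)` is the derivative of `-x (1 - P)`, which vanishes at `1`. -/
theorem integral_virtualValue (h : IsDensity ρ) {a : ℝ} (ha : a ∈ Icc (0 : ℝ) 1) :
    ∫ x in a..1, virtualValue ρ x * ρ x = a * (1 - distFun ρ a) := by
  have hsub : Icc a 1 ⊆ Icc 0 1 := Icc_subset_Icc_left ha.1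
  have hρ := h.continuousOn.mono hsub
  have hP := h.continuousOn_distFun.mono hsub
  have h1 : ∫ x in a..1, virtualValue ρ x * ρ x = ∫ x in a..1, (x * ρ x - (1 - distFun ρ x)) := by
    refine intervalIntegral.integral_congr fun x hx => ?_
    rw [uIcc_of_le ha.2] at hx
    have := (h.pos x (hsub hx)).ne'
    simp only [virtualValue]
    field_simp
  rw [h1, intervalIntegral.integral_eq_sub_of_hasDerivAt_of_le
    (f := fun x => -(x * (1 - distFun ρ x))) ha.2]
  · simp [h.distFun_one]
  · fun_prop
  · intro x hx
    have hd := h.hasDerivAt_distFun ⟨ha.1.trans_lt hx.1, hx.2⟩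
    convert! ((hasDerivAt_id x).mul ((hasDerivAt_const x 1).sub hd)).neg using 1
    simp
    ring
  · refine ContinuousOn.intervalIntegrable ?_
    rw [uIcc_of_le ha.2]
    fun_prop

/-- The curve `G_V` of the virtual valuation is `Q(t) (1 - t)`. -/
theorem curve_virtualValue (h : IsDensity ρ) {t : ℝ} (ht : t ∈ Icc (0 : ℝ) 1) :
    curve ρ (virtualValue ρ) t = quantile ρ t * (1 - t) := by
  rw [curve, h.integral_virtualValue (h.quantile_mem ht), h.distFun_quantile ht]

end IsDensity

/-! ### The concave envelope -/

theorem IsMajorant.envelope_le {G g : ℝ → ℝ} (hg : IsMajorant G g) {t : ℝ}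
    (ht : t ∈ Icc (0 : ℝ) 1) : envelope G t ≤ g t :=
  csInf_le ⟨0, by rintro _ ⟨g, hg, rfl⟩; exact hg.nonneg t ht⟩ ⟨g, hg, rfl⟩

theorem IsMajorant.le_envelope {G g : ℝ → ℝ} (hg : IsMajorant G g) {t c : ℝ}
    (hc : ∀ g, IsMajorant G g → c ≤ g t) : c ≤ envelope G t :=
  le_csInf ⟨_, g, hg, rfl⟩ (by rintro _ ⟨g, hg, rfl⟩; exact hc g hg)

/-- If `G` has a majorant at all, then its envelope is one. -/
theorem IsMajorant.isMajorant_envelope {G g : ℝ → ℝ} (hg : IsMajorant G g) :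
    IsMajorant G (envelope G) where
  concave := by
    refine ⟨convex_Icc 0 1, fun s hs t ht a b ha hb hab => hg.le_envelope fun g' hg' => ?_⟩
    refine le_trans ?_ (hg'.concave.2 hs ht ha hb hab)
    simp only [smul_eq_mul]
    exact add_le_add (mul_le_mul_of_nonneg_left (hg'.envelope_le hs) ha)
      (mul_le_mul_of_nonneg_left (hg'.envelope_le ht) hb)
  antitone := fun s hs t ht hst => hg.le_envelope fun g' hg' =>
    (hg'.envelope_le ht).trans (hg'.antitone hs ht hst)
  nonneg := fun t ht => hg.le_envelope fun g' hg' => hg'.nonneg t ht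
  le := fun t ht => hg.le_envelope fun g' hg' => hg'.le t ht

namespace IsDensity

variable {ρ : ℝ → ℝ}

/-- Follows from `Q ≤ 1`. It shows that the infimum is over a nonempty family, and it pins the
envelope to `0` at `1` with slope at least `-1`. -/
theorem isMajorant_one_sub (h : IsDensity ρ) :
    IsMajorant (curve ρ (virtualValue ρ)) (fun t => 1 - t) where
  concave := (concaveOn_const 1 (convex_Icc 0 1)).sub (convexOn_id (convex_Icc 0 1))
  antitone := fun s _ t _ hst => sub_le_sub_left hst 1
  nonneg := fun t ht => by simpa using ht.2
  le := fun t ht => by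
    rw [h.curve_virtualValue ht]
    exact mul_le_of_le_one_left (by linarith [ht.2]) (h.quantile_mem ht).2

theorem isMajorant_ironedCurve (h : IsDensity ρ) :
    IsMajorant (curve ρ (virtualValue ρ)) (ironedCurve ρ) :=
  h.isMajorant_one_sub.isMajorant_envelope

theorem ironedCurve_le_one_sub (h : IsDensity ρ) {t : ℝ} (ht : t ∈ Icc (0 : ℝ) 1) :
    ironedCurve ρ t ≤ 1 - t :=
  h.isMajorant_one_sub.envelope_le ht

theorem ironedCurve_one (h : IsDensity ρ) : ironedCurve ρ 1 = 0 :=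
  le_antisymm (by simpa using h.ironedCurve_le_one_sub (t := 1) (by simp))
    (h.isMajorant_ironedCurve.nonneg 1 (by simp))

/-- The chord from `t` to `1` has slope at least `-1`, because the envelope is below `1 - t` and
vanishes at `1`; by concavity chords further left have larger slope. -/
theorem ironedCurve_sub_le (h : IsDensity ρ) {s t : ℝ} (hs : s ∈ Icc (0 : ℝ) 1)
    (ht : t ∈ Icc (0 : ℝ) 1) (hst : s ≤ t) : ironedCurve ρ s - ironedCurve ρ t ≤ t - s := by
  rcases hst.eq_or_lt with rfl | hst
  · simp
  rcases ht.2.eq_or_lt with rfl | ht1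
  · rw [h.ironedCurve_one]
    linarith [h.ironedCurve_le_one_sub hs]
  have h1 := h.isMajorant_ironedCurve.concave.slope_anti_adjacent hs (by simp : (1 : ℝ) ∈ _) hst ht1
  have h2 : -1 ≤ (ironedCurve ρ 1 - ironedCurve ρ t) / (1 - t) := by
    rw [le_div_iff₀ (by linarith), h.ironedCurve_one]
    linarith [h.ironedCurve_le_one_sub ht]
  have h3 := h2.trans h1
  rw [le_div_iff₀ (by linarith)] at h3
  linarith

theorem lipschitzOnWith_ironedCurve (h : IsDensity ρ) :
    LipschitzOnWith 1 (ironedCurve ρ) (Icc 0 1) := by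
  refine LipschitzOnWith.of_dist_le_mul fun s hs t ht => ?_
  rw [NNReal.coe_one, one_mul, Real.dist_eq, Real.dist_eq]
  wlog hst : s ≤ t generalizing s t
  · rw [abs_sub_comm, abs_sub_comm s]
    exact this t ht s hs (le_of_not_ge hst)
  have h1 := h.ironedCurve_sub_le hs ht hst
  have h2 := h.isMajorant_ironedCurve.antitone hs ht hst
  rw [abs_of_nonneg (by linarith), abs_of_nonpos (by linarith)]
  linarith

end IsDensity

/-! ### The derivative of the envelope -/

/-- The rate of decrease of the ironed curve, as a non-decreasing function on the real line with
values in `[0,1]`. -/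
noncomputable def ironedRate (ρ : ℝ → ℝ) (t : ℝ) : ℝ :=
  -- A right derivative exists at every interior point; the outer values `0` and `1` bound it, so
  -- monotonicity, and with it measurability, holds on the whole line.
  if t ≤ 0 then 0 else if 1 ≤ t then 1 else derivWithin (-ironedCurve ρ) (Ioi t) t

namespace IsDensity

variable {ρ : ℝ → ℝ}

theorem convexOn_neg_ironedCurve (h : IsDensity ρ) : ConvexOn ℝ (Icc 0 1) (-ironedCurve ρ) :=
  h.isMajorant_ironedCurve.concave.neg

theorem hasDerivWithinAt_neg_ironedCurve (h : IsDensity ρ) {t : ℝ} (ht : t ∈ Ioo (0 : ℝ) 1) :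
    HasDerivWithinAt (-ironedCurve ρ) (ironedRate ρ t) (Ioi t) t := by
  rw [ironedRate, if_neg ht.1.not_ge, if_neg ht.2.not_ge]
  exact h.convexOn_neg_ironedCurve.hasDerivWithinAt_rightDeriv_of_mem_interior
    (by rwa [interior_Icc])

theorem ironedRate_mem (h : IsDensity ρ) (t : ℝ) : ironedRate ρ t ∈ Icc (0 : ℝ) 1 := by
  by_cases h0 : t ≤ 0
  · simp [ironedRate, h0]
  by_cases h1 : 1 ≤ t
  · simp [ironedRate, h0, h1]
  have ht : t ∈ Ioo (0 : ℝ) 1 := ⟨not_le.1 h0, not_le.1 h1⟩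
  have hd := h.hasDerivWithinAt_neg_ironedCurve ht
  rw [hasDerivWithinAt_iff_tendsto_slope' (by simp)] at hd
  refine isClosed_Icc.mem_of_tendsto hd ?_
  filter_upwards [Ioo_mem_nhdsGT ht.2] with s hs
  have hts : 0 < s - t := by linarith [hs.1]
  have hs' : s ∈ Icc (0 : ℝ) 1 := ⟨by linarith [ht.1], hs.2.le⟩
  have h1 := h.ironedCurve_sub_le (Ioo_subset_Icc_self ht) hs' hs.1.le
  have h2 := h.isMajorant_ironedCurve.antitone (Ioo_subset_Icc_self ht) hs' hs.1.le
  rw [slope_def_field]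
  refine ⟨div_nonneg ?_ hts.le, (div_le_one hts).2 ?_⟩ <;> simp only [Pi.neg_apply] <;> linarith

theorem monotone_ironedRate (h : IsDensity ρ) : Monotone (ironedRate ρ) := by
  intro s t hst
  by_cases hs : s ≤ 0
  · rw [ironedRate, if_pos hs]; exact (h.ironedRate_mem t).1
  by_cases ht : 1 ≤ t
  · have : ironedRate ρ t = 1 := by rw [ironedRate, if_neg (by linarith), if_pos ht]
    rw [this]; exact (h.ironedRate_mem s).2
  push Not at hs ht
  rw [ironedRate, ironedRate, if_neg hs.not_ge, if_neg (hst.trans_lt ht).not_ge,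
    if_neg (hs.trans_le hst).not_ge, if_neg ht.not_ge]
  refine h.convexOn_neg_ironedCurve.monotoneOn_rightDeriv ?_ ?_ hst <;> rw [interior_Icc]
  exacts [⟨hs, hst.trans_lt ht⟩, ⟨hs.trans_le hst, ht⟩]

theorem intervalIntegrable_ironedRate (h : IsDensity ρ) (a b : ℝ) :
    IntervalIntegrable (ironedRate ρ) volume a b :=
  (h.monotone_ironedRate.monotoneOn _).intervalIntegrable

/-- The ironed curve is the tail integral of its rate of decrease. -/
theorem ironedCurve_eq_integral (h : IsDensity ρ) {t : ℝ} (ht : t ∈ Icc (0 : ℝ) 1) :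
    ironedCurve ρ t = ∫ s in t..1, ironedRate ρ s := by
  -- This form of the fundamental theorem needs only right derivatives, so kinks of the envelope do
  -- no harm.
  rw [intervalIntegral.integral_eq_sub_of_hasDeriv_right_of_le (f := -ironedCurve ρ) ht.2
    (h.lipschitzOnWith_ironedCurve.continuousOn.mono (Icc_subset_Icc_left ht.1)).neg
    (fun s hs => h.hasDerivWithinAt_neg_ironedCurve ⟨ht.1.trans_lt hs.1, hs.2⟩)
    (h.intervalIntegrable_ironedRate _ _)]
  simp [h.ironedCurve_one]

/-- A Lipschitz function is differentiable almost everywhere, and there its derivative agrees with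
the right one. -/
theorem ae_hasDerivAt_ironedCurve (h : IsDensity ρ) :
    ∀ᵐ t ∂(volume.restrict (Icc (0 : ℝ) 1)),
      HasDerivAt (ironedCurve ρ) (-ironedRate ρ t) t := by
  have h1 := h.lipschitzOnWith_ironedCurve.ae_differentiableWithinAt_real measurableSet_Icc
  have h2 : ∀ᵐ t ∂(volume.restrict (Icc (0 : ℝ) 1)), t ∈ Ioo (0 : ℝ) 1 := by
    rw [← restrict_Ioo_eq_restrict_Icc]
    exact ae_restrict_mem measurableSet_Ioo
  filter_upwards [h1, h2] with t ht1 ht2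
  have hd := (ht1.differentiableAt (Icc_mem_nhds ht2.1 ht2.2)).hasDerivAt
  have hr := h.hasDerivWithinAt_neg_ironedCurve ht2
  have := (uniqueDiffWithinAt_Ioi t).eq_deriv _ hr hd.neg.hasDerivWithinAt
  rwa [this, neg_neg]

theorem ae_ironedValue (h : IsDensity ρ) :
    ∀ᵐ x ∂(valueDist ρ), DifferentiableAt ℝ (ironedCurve ρ) (distFun ρ x) ∧
      ironedValue ρ x = ironedRate ρ (distFun ρ x) := by
  filter_upwards [h.ae_distFun h.ae_hasDerivAt_ironedCurve] with x hx
  exact ⟨hx.differentiableAt, by rw [ironedValue, hx.deriv, neg_neg]⟩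

theorem ironedCurve_eq_curve (h : IsDensity ρ) {t : ℝ} (ht : t ∈ Icc (0 : ℝ) 1) :
    ironedCurve ρ t = curve ρ (ironedValue ρ) t := by
  rw [h.ironedCurve_eq_integral ht, ← h.integral_distFun h.monotone_ironedRate.measurable ht,
    curve, ← h.setIntegral_valueDist _ (h.quantile_mem ht),
    ← h.setIntegral_valueDist _ (h.quantile_mem ht)]
  refine integral_congr_ae (ae_restrict_of_ae ?_)
  filter_upwards [h.ae_ironedValue] with x hx
  exact hx.2.symm

/-- The ironed curve as a lower integral. -/
theorem ofReal_ironedCurve (h : IsDensity ρ) {t : ℝ} (ht : t ∈ Icc (0 : ℝ) 1) :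
    ENNReal.ofReal (ironedCurve ρ t) = ∫⁻ s in Ioc t 1, ENNReal.ofReal (ironedRate ρ s) := by
  rw [h.ironedCurve_eq_integral ht, intervalIntegral.integral_of_le ht.2,
    ofReal_integral_eq_lintegral_ofReal (h.intervalIntegrable_ironedRate t 1).1
      (.of_forall fun s => (h.ironedRate_mem s).1)]

end IsDensity

/-! ### Feasibility as a bound on tail masses -/

/-- Tonelli's theorem on the triangle `0 ≤ a ≤ x ≤ 1`. -/
theorem lintegral_Icc_lintegral_Icc (ν : Measure ℝ) [SFinite ν] {k : ℝ → ℝ≥0∞}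
    (hk : Measurable k) :
    ∫⁻ x in Icc (0 : ℝ) 1, (∫⁻ a in Icc 0 x, k a) ∂ν
      = ∫⁻ a in Icc (0 : ℝ) 1, k a * ν (Icc a 1) := by
  have hset : MeasurableSet {p : ℝ × ℝ | p.2 ≤ p.1} := measurableSet_le measurable_snd measurable_fst
  have hmeas : Measurable (Function.uncurry fun x a : ℝ => (Iic x).indicator k a) := by
    have : (Function.uncurry fun x a : ℝ => (Iic x).indicator k a)
        = {p : ℝ × ℝ | p.2 ≤ p.1}.indicator (fun p => k p.2) := by
      ext ⟨x, a⟩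
      simp [indicator_apply]
    rw [this]
    exact (hk.comp measurable_snd).indicator hset
  have h1 : ∀ x ∈ Icc (0 : ℝ) 1,
      ∫⁻ a in Icc 0 x, k a = ∫⁻ a in Icc (0 : ℝ) 1, (Iic x).indicator k a := by
    intro x hx
    rw [setLIntegral_indicator measurableSet_Iic]
    congr 2
    ext a
    simp only [mem_Icc, mem_inter_iff, mem_Iic]
    constructor
    · rintro ⟨h2, h3⟩; exact ⟨h3, h2, h3.trans hx.2⟩
    · rintro ⟨h2, h3, -⟩; exact ⟨h3, h2⟩
  rw [setLIntegral_congr_fun measurableSet_Icc h1, lintegral_lintegral_swap hmeas.aemeasurable]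
  refine setLIntegral_congr_fun measurableSet_Icc fun a ha => ?_
  have h2 : (fun x => (Iic x).indicator k a) = (Ici a).indicator fun _ => k a := by
    ext x; simp [indicator_apply]
  simp only [h2]
  rw [setLIntegral_indicator measurableSet_Ici, setLIntegral_const]
  congr 2
  ext x
  simp only [mem_Icc, mem_inter_iff, mem_Ici]
  constructor
  · rintro ⟨h3, -, h4⟩; exact ⟨h3, h4⟩
  · rintro ⟨h3, h4⟩; exact ⟨h3, ha.1.trans h3, h4⟩

namespace IsTest

variable {u : ℝ → ℝ}

theorem differentiableOn (hu : IsTest u) : DifferentiableOn ℝ u (Icc 0 1) :=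
  hu.smooth.differentiableOn (by simp)

theorem contDiffOn_derivWithin (hu : IsTest u) :
    ContDiffOn ℝ ∞ (derivWithin u (Icc 0 1)) (Icc 0 1) :=
  ((contDiffOn_infty_iff_derivWithin (uniqueDiffOn_Icc zero_lt_one)).1 hu.smooth).2

theorem continuousOn_deriv2 (hu : IsTest u) :
    ContinuousOn (derivWithin (derivWithin u (Icc 0 1)) (Icc 0 1)) (Icc 0 1) :=
  ((contDiffOn_infty_iff_derivWithin (uniqueDiffOn_Icc zero_lt_one)).1
    hu.contDiffOn_derivWithin).2.continuousOn

theorem deriv_nonneg (hu : IsTest u) (x : ℝ) : 0 ≤ derivWithin u (Icc 0 1) x :=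
  hu.monotone.derivWithin_nonneg

theorem deriv2_nonneg (hu : IsTest u) (x : ℝ) :
    0 ≤ derivWithin (derivWithin u (Icc 0 1)) (Icc 0 1) x :=
  (hu.convex.monotoneOn_derivWithin hu.differentiableOn).derivWithin_nonneg

theorem hasDerivAt (hu : IsTest u) {x : ℝ} (hx : x ∈ Ioo (0 : ℝ) 1) :
    HasDerivAt u (derivWithin u (Icc 0 1) x) x :=
  (hu.differentiableOn x (Ioo_subset_Icc_self hx)).hasDerivWithinAt.hasDerivAt
    (Icc_mem_nhds hx.1 hx.2)

theorem hasDerivAt_deriv (hu : IsTest u) {x : ℝ} (hx : x ∈ Ioo (0 : ℝ) 1) :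
    HasDerivAt (derivWithin u (Icc 0 1)) (derivWithin (derivWithin u (Icc 0 1)) (Icc 0 1) x) x :=
  (hu.contDiffOn_derivWithin.differentiableOn (by simp) x
    (Ioo_subset_Icc_self hx)).hasDerivWithinAt.hasDerivAt (Icc_mem_nhds hx.1 hx.2)

theorem ofReal_deriv_sub (hu : IsTest u) {x : ℝ} (hx : x ∈ Icc (0 : ℝ) 1) :
    ENNReal.ofReal (derivWithin u (Icc 0 1) x - derivWithin u (Icc 0 1) 0)
      = ∫⁻ a in Icc 0 x, ENNReal.ofReal (derivWithin (derivWithin u (Icc 0 1)) (Icc 0 1) a) := by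
  have hsub : Icc 0 x ⊆ Icc (0 : ℝ) 1 := Icc_subset_Icc_right hx.2
  have hc := hu.continuousOn_deriv2.mono hsub
  rw [← ofReal_integral_eq_lintegral_ofReal hc.integrableOn_Icc
    (.of_forall fun a => hu.deriv2_nonneg a), integral_Icc_eq_integral_Ioc,
    ← intervalIntegral.integral_of_le hx.1,
    intervalIntegral.integral_eq_sub_of_hasDerivAt_of_le hx.1
      (hu.contDiffOn_derivWithin.continuousOn.mono hsub)
      (fun a ha => hu.hasDerivAt_deriv ⟨ha.1, ha.2.trans_le hx.2⟩)]
  exact ContinuousOn.intervalIntegrable (by rwa [uIcc_of_le hx.1])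

/-- `(x u' - u)' = x u''`, and `x u' - u` vanishes at `0` because `u(0) = 0`. -/
theorem integral_mul_deriv2 (hu : IsTest u) {x : ℝ} (hx : x ∈ Icc (0 : ℝ) 1) :
    x * derivWithin u (Icc 0 1) x - u x
      = ∫ a in Icc 0 x, a * derivWithin (derivWithin u (Icc 0 1)) (Icc 0 1) a := by
  have hsub : Icc 0 x ⊆ Icc (0 : ℝ) 1 := Icc_subset_Icc_right hx.2
  have hc := hu.continuousOn_deriv2.mono hsub
  have hc1 := hu.contDiffOn_derivWithin.continuousOn.mono hsub
  have hc2 := hu.differentiableOn.continuousOn.mono hsub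
  rw [integral_Icc_eq_integral_Ioc, ← intervalIntegral.integral_of_le hx.1,
    intervalIntegral.integral_eq_sub_of_hasDerivAt_of_le
      (f := fun a => a * derivWithin u (Icc 0 1) a - u a) hx.1]
  · simp [hu.zero]
  · fun_prop
  · intro a ha
    have ha' : a ∈ Ioo (0 : ℝ) 1 := ⟨ha.1, ha.2.trans_le hx.2⟩
    convert! ((hasDerivAt_id a).mul (hu.hasDerivAt_deriv ha')).sub (hu.hasDerivAt ha') using 1
    simp
  · refine ContinuousOn.intervalIntegrable ?_
    rw [uIcc_of_le hx.1]
    fun_prop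

theorem mul_deriv_sub_nonneg (hu : IsTest u) {x : ℝ} (hx : x ∈ Icc (0 : ℝ) 1) :
    0 ≤ x * derivWithin u (Icc 0 1) x - u x := by
  rw [hu.integral_mul_deriv2 hx]
  exact setIntegral_nonneg measurableSet_Icc fun a ha => mul_nonneg ha.1 (hu.deriv2_nonneg a)

theorem ofReal_mul_deriv_sub (hu : IsTest u) {x : ℝ} (hx : x ∈ Icc (0 : ℝ) 1) :
    ENNReal.ofReal (x * derivWithin u (Icc 0 1) x - u x)
      = ∫⁻ a in Icc 0 x,
          ENNReal.ofReal (a * derivWithin (derivWithin u (Icc 0 1)) (Icc 0 1) a) := by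
  have hc := hu.continuousOn_deriv2.mono (Icc_subset_Icc_right hx.2 : Icc 0 x ⊆ Icc (0 : ℝ) 1)
  have hc' : ContinuousOn
      (fun a => a * derivWithin (derivWithin u (Icc 0 1)) (Icc 0 1) a) (Icc 0 x) := by fun_prop
  rw [hu.integral_mul_deriv2 hx, ofReal_integral_eq_lintegral_ofReal hc'.integrableOn_Icc]
  filter_upwards [ae_restrict_mem measurableSet_Icc] with a ha
  exact mul_nonneg ha.1 (hu.deriv2_nonneg a)

end IsTest

namespace IsDensity

variable {ρ : ℝ → ℝ}

/-- After Tonelli both sides are integrals of `u''(a) ≥ 0`, against `a μ([a,1])` and `ς([a,1])`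
respectively, and these weights are compared pointwise. -/
theorem isFeasible_of_le (h : IsDensity ρ) {ς : Measure ℝ} (hς : IsMeasureOnUnit ς)
    (hle : ∀ a ∈ Icc (0 : ℝ) 1, ENNReal.ofReal (a * (1 - distFun ρ a)) ≤ ς (Icc a 1)) :
    IsFeasible ρ ς := by
  refine ⟨hς, fun u hu => ?_⟩
  have := hς.1
  have := h.isProbabilityMeasure
  have hres : (valueDist ρ).restrict (Icc 0 1) = valueDist ρ :=
    Measure.restrict_eq_self_of_ae_mem (ae_mem ρ)
  set w := derivWithin u (Icc 0 1) with hw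
  -- A continuous extension of `u''` to the line, to have a globally measurable integrand for
  -- Tonelli.
  obtain ⟨g, hg, hgI⟩ : ∃ g : ℝ → ℝ, Continuous g ∧
      ∀ a ∈ Icc (0 : ℝ) 1, g a = derivWithin w (Icc 0 1) a :=
    ⟨IccExtend zero_le_one ((Icc 0 1).domRestrict (derivWithin w (Icc 0 1))),
      hu.continuousOn_deriv2.domRestrict.Icc_extend', fun a ha => IccExtend_of_mem _ _ ha⟩
  have hwc : ContinuousOn w (Icc 0 1) := hu.contDiffOn_derivWithin.continuousOn
  have huc : ContinuousOn u (Icc 0 1) := hu.differentiableOn.continuousOn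
  have hint : Integrable (fun x => x * w x - u x) (valueDist ρ) := by
    rw [← hres]
    exact (by fun_prop : ContinuousOn (fun x => x * w x - u x) (Icc 0 1)).integrableOn_compact
      isCompact_Icc
  have hint' : IntegrableOn w (Icc 0 1) ς := hwc.integrableOn_compact isCompact_Icc
  have hnn : 0 ≤ᵐ[valueDist ρ] fun x => x * w x - u x := by
    filter_upwards [ae_mem ρ] with x hx using hu.mul_deriv_sub_nonneg hx
  rw [← h.integral_valueDist, ← ENNReal.ofReal_le_ofReal_iff
    (integral_nonneg_of_ae (.of_forall fun x => hu.deriv_nonneg x)),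
    ofReal_integral_eq_lintegral_ofReal hint hnn,
    ofReal_integral_eq_lintegral_ofReal hint' (.of_forall fun x => hu.deriv_nonneg x)]
  have hI : ∀ x ∈ Icc (0 : ℝ) 1, ∀ a ∈ Icc 0 x, g a = derivWithin w (Icc 0 1) a :=
    fun x hx a ha => hgI a ⟨ha.1, ha.2.trans hx.2⟩
  calc ∫⁻ x, ENNReal.ofReal (x * w x - u x) ∂(valueDist ρ)
      = ∫⁻ x in Icc (0 : ℝ) 1, (∫⁻ a in Icc 0 x, ENNReal.ofReal (a * g a)) ∂(valueDist ρ) := by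
        rw [← hres, Measure.restrict_restrict measurableSet_Icc, inter_self]
        refine setLIntegral_congr_fun measurableSet_Icc fun x hx => ?_
        rw [hw, hu.ofReal_mul_deriv_sub hx]
        exact setLIntegral_congr_fun measurableSet_Icc fun a ha => by rw [hI x hx a ha]
    _ = ∫⁻ a in Icc (0 : ℝ) 1, ENNReal.ofReal (a * g a) * valueDist ρ (Icc a 1) :=
        lintegral_Icc_lintegral_Icc _ (by fun_prop)
    _ ≤ ∫⁻ a in Icc (0 : ℝ) 1, ENNReal.ofReal (g a) * ς (Icc a 1) := by
        refine setLIntegral_mono' measurableSet_Icc fun a ha => ?_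
        refine le_trans (le_of_eq ?_) (mul_le_mul_right (hle a ha) _)
        have hga : 0 ≤ g a := by rw [hgI a ha]; exact hu.deriv2_nonneg a
        rw [h.valueDist_Icc ha (by simp) ha.2, h.distFun_one,
          ← ENNReal.ofReal_mul (mul_nonneg ha.1 hga), ← ENNReal.ofReal_mul hga]
        ring_nf
    _ = ∫⁻ x in Icc (0 : ℝ) 1, (∫⁻ a in Icc 0 x, ENNReal.ofReal (g a)) ∂ς :=
        (lintegral_Icc_lintegral_Icc _ (by fun_prop)).symm
    _ ≤ ∫⁻ x in Icc (0 : ℝ) 1, ENNReal.ofReal (w x) ∂ς := by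
        refine setLIntegral_mono' measurableSet_Icc fun x hx => ?_
        have h1 : ∫⁻ a in Icc 0 x, ENNReal.ofReal (g a) = ENNReal.ofReal (w x - w 0) := by
          rw [hw, hu.ofReal_deriv_sub hx]
          exact setLIntegral_congr_fun measurableSet_Icc fun a ha => by rw [hI x hx a ha]
        rw [h1]
        -- The leftover term `u'(0)` is non-negative and helps.
        exact ENNReal.ofReal_le_ofReal (sub_le_self _ (hu.deriv_nonneg 0))

end IsDensity

/-- A smooth convex non-decreasing function that vanishes up to `a - ε` and has slope one
from `a` on. -/
noncomputable def rampTest (a ε x : ℝ) : ℝ :=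
  ∫ s in (0 : ℝ)..x, Real.smoothTransition ((s - a) / ε + 1)

section rampTest

variable {a ε : ℝ}

theorem continuous_rampTest_integrand (a ε : ℝ) :
    Continuous fun s : ℝ => Real.smoothTransition ((s - a) / ε + 1) :=
  Real.smoothTransition.continuous.comp (by fun_prop)

theorem hasDerivAt_rampTest (a ε x : ℝ) :
    HasDerivAt (rampTest a ε) (Real.smoothTransition ((x - a) / ε + 1)) x :=
  ((continuous_rampTest_integrand a ε).integral_hasStrictDerivAt 0 x).hasDerivAt

theorem isTest_rampTest (hε : 0 < ε) : IsTest (rampTest a ε) := by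
  have hderiv : deriv (rampTest a ε) = fun x => Real.smoothTransition ((x - a) / ε + 1) :=
    funext fun x => (hasDerivAt_rampTest a ε x).deriv
  have hdiff : Differentiable ℝ (rampTest a ε) :=
    fun x => (hasDerivAt_rampTest a ε x).differentiableAt
  refine ⟨ContDiff.contDiffOn (contDiff_infty_iff_deriv.2 ⟨hdiff, ?_⟩), ?_, ?_, by simp [rampTest]⟩
  · rw [hderiv]
    exact Real.smoothTransition.contDiff.comp (by fun_prop)
  · refine MonotoneOn.convexOn_of_deriv (convex_Icc 0 1) hdiff.continuous.continuousOn
      hdiff.differentiableOn (Monotone.monotoneOn ?_ _)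
    rw [hderiv]
    intro x y hxy
    exact Real.smoothTransition.monotone (by gcongr)
  · refine Monotone.monotoneOn (monotone_of_deriv_nonneg hdiff fun x => ?_) _
    rw [hderiv]
    exact Real.smoothTransition.nonneg _

theorem derivWithin_rampTest {x : ℝ} (hx : x ∈ Icc (0 : ℝ) 1) :
    derivWithin (rampTest a ε) (Icc 0 1) x = Real.smoothTransition ((x - a) / ε + 1) :=
  (hasDerivAt_rampTest a ε x).hasDerivWithinAt.derivWithin (uniqueDiffOn_Icc zero_lt_one x hx)

/-- The slope is zero up to `a - ε` and at most one afterwards. -/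
theorem rampTest_le (hε : 0 < ε) (hεa : ε ≤ a) {x : ℝ} (hx : a ≤ x) :
    rampTest a ε x ≤ x - (a - ε) := by
  have hi := (continuous_rampTest_integrand a ε).intervalIntegrable (μ := volume)
  have h1 : ∫ s in (0 : ℝ)..(a - ε), Real.smoothTransition ((s - a) / ε + 1) = 0 := by
    rw [intervalIntegral.integral_congr (g := fun _ => 0), intervalIntegral.integral_zero]
    intro s hs
    rw [uIcc_of_le (by linarith)] at hs
    refine Real.smoothTransition.zero_of_nonpos ?_
    have : (s - a) / ε ≤ -1 := by rw [div_le_iff₀ hε]; linarith [hs.2]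
    linarith
  rw [rampTest, ← intervalIntegral.integral_add_adjacent_intervals (hi 0 (a - ε)) (hi _ x), h1,
    zero_add]
  calc _ ≤ ∫ s in (a - ε)..x, (1 : ℝ) :=
        intervalIntegral.integral_mono_on (by linarith) (hi _ _) (by simp)
          fun s _ => Real.smoothTransition.le_one _
    _ = x - (a - ε) := by simp

end rampTest

namespace IsDensity

variable {ρ : ℝ → ℝ}

/-- Test with the ramp: on `[a,1]` its slope is one, so `x u' - u ≥ a - ε`, while `u'` is at most
the indicator of `[a - ε, 1]`. -/
theorem le_of_isFeasible_aux (h : IsDensity ρ) {ς : Measure ℝ} (hς : IsFeasible ρ ς) {a ε : ℝ}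
    (ha : a ∈ Icc (0 : ℝ) 1) (hε : 0 < ε) (hεa : ε ≤ a) :
    ENNReal.ofReal ((a - ε) * (1 - distFun ρ a)) ≤ ς (Icc (a - ε) 1) := by
  have := hς.1.1
  have hu := isTest_rampTest (a := a) hε
  have hsub : Icc a 1 ⊆ Icc (0 : ℝ) 1 := Icc_subset_Icc_left ha.1
  have hwc : ContinuousOn (derivWithin (rampTest a ε) (Icc 0 1)) (Icc 0 1) :=
    hu.contDiffOn_derivWithin.continuousOn
  have huc : ContinuousOn (rampTest a ε) (Icc 0 1) := hu.differentiableOn.continuousOn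
  have hρ := h.continuousOn
  have h1 : (a - ε) * (1 - distFun ρ a) ≤ ∫ x in Icc (0 : ℝ) 1,
      (x * derivWithin (rampTest a ε) (Icc 0 1) x - rampTest a ε x) * ρ x := by
    have h0 := h.distFun_sub ha (by simp : (1 : ℝ) ∈ Icc (0 : ℝ) 1)
    rw [h.distFun_one] at h0
    rw [h0, intervalIntegral.integral_of_le ha.2,
      ← integral_Icc_eq_integral_Ioc, ← integral_const_mul]
    refine le_trans (setIntegral_mono_on ?_ ?_ measurableSet_Icc fun x hx => ?_)
      (setIntegral_mono_set ?_ ?_ (LE.le.eventuallyLE hsub))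
    · exact ((hρ.mono hsub).integrableOn_Icc).const_mul _
    · exact ContinuousOn.integrableOn_Icc (ContinuousOn.mono (by fun_prop) hsub)
    · refine mul_le_mul_of_nonneg_right ?_ (h.pos x (hsub hx)).le
      rw [derivWithin_rampTest (hsub hx), Real.smoothTransition.one_of_one_le]
      · linarith [rampTest_le hε hεa hx.1]
      · have : 0 ≤ (x - a) / ε := div_nonneg (by linarith [hx.1]) hε.le
        linarith
    · exact ContinuousOn.integrableOn_Icc (by fun_prop)
    · filter_upwards [ae_restrict_mem measurableSet_Icc] with x hx
      exact mul_nonneg (hu.mul_deriv_sub_nonneg hx) (h.pos x hx).le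
  have h2 : ∫ x in Icc (0 : ℝ) 1, derivWithin (rampTest a ε) (Icc 0 1) x ∂ς
      ≤ ς.real (Icc (a - ε) 1) := by
    have hsub' : Icc (a - ε) 1 ⊆ Icc (0 : ℝ) 1 := Icc_subset_Icc_left (by linarith)
    have h3 : ∫ x in Icc (0 : ℝ) 1, (Icc (a - ε) 1).indicator (fun _ => (1 : ℝ)) x ∂ς
        = ς.real (Icc (a - ε) 1) := by
      rw [setIntegral_indicator measurableSet_Icc, inter_eq_self_of_subset_right hsub']
      simp
    rw [← h3]
    refine setIntegral_mono_on (hwc.integrableOn_compact isCompact_Icc)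
      ((integrable_const 1).indicator measurableSet_Icc) measurableSet_Icc fun x hx => ?_
    rw [derivWithin_rampTest hx]
    by_cases hxa : x ∈ Icc (a - ε) 1
    · rw [indicator_of_mem hxa]; exact Real.smoothTransition.le_one _
    · rw [indicator_of_notMem hxa]
      refine (Real.smoothTransition.zero_of_nonpos ?_).le
      have : x < a - ε := by by_contra hc; exact hxa ⟨not_lt.1 hc, hx.2⟩
      have : (x - a) / ε ≤ -1 := by rw [div_le_iff₀ hε]; linarith
      linarith
  rw [← ofReal_measureReal]
  exact ENNReal.ofReal_le_ofReal (h1.trans ((hς.2 _ hu).trans h2))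

/-- Let the ramp steepen: `[a - ε, 1]` decreases to `[a,1]` as `ε → 0`, and `ς` is continuous from
above. At `a = 0` no ramp fits, but the bound is trivial. -/
theorem le_of_isFeasible (h : IsDensity ρ) {ς : Measure ℝ} (hς : IsFeasible ρ ς) {a : ℝ}
    (ha : a ∈ Icc (0 : ℝ) 1) :
    ENNReal.ofReal (a * (1 - distFun ρ a)) ≤ ς (Icc a 1) := by
  have := hς.1.1
  rcases ha.1.eq_or_lt with rfl | ha0
  · simp
  have h1 : Tendsto (ς ∘ fun ε => Icc (a - ε) 1) (𝓝[>] 0)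
      (𝓝 (ς (⋂ ε, ⋂ (_ : ε > 0), Icc (a - ε) 1))) :=
    tendsto_measure_biInter_gt (fun ε _ => measurableSet_Icc.nullMeasurableSet)
      (fun i j _ hij => Icc_subset_Icc_left (by linarith)) ⟨1, one_pos, measure_ne_top _ _⟩
  have h2 : ⋂ ε, ⋂ (_ : ε > 0), Icc (a - ε) 1 = Icc a 1 := by
    ext x
    simp only [mem_iInter, mem_Icc]
    constructor
    · intro hx
      exact ⟨le_of_forall_pos_sub_le fun ε hε => (hx ε hε).1, (hx 1 one_pos).2⟩
    · rintro ⟨h3, h4⟩ ε hε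
      exact ⟨by linarith, h4⟩
  rw [h2] at h1
  have h3 : Tendsto (fun ε => ENNReal.ofReal ((a - ε) * (1 - distFun ρ a))) (𝓝[>] 0)
      (𝓝 (ENNReal.ofReal (a * (1 - distFun ρ a)))) := by
    refine (Tendsto.mono_left ?_ nhdsWithin_le_nhds)
    have : Continuous fun ε => ENNReal.ofReal ((a - ε) * (1 - distFun ρ a)) :=
      ENNReal.continuous_ofReal.comp (by fun_prop)
    simpa using this.tendsto 0
  refine le_of_tendsto_of_tendsto h3 h1 ?_
  filter_upwards [Ioc_mem_nhdsGT ha0] with ε hε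
  exact h.le_of_isFeasible_aux hς ha hε.1 hε.2

end IsDensity

/-! ### Quantile functions of probability measures on `[0,∞]` -/

/-- The non-decreasing rearrangement: the quantile function of a measure on `[0,∞]`. -/
noncomputable def quantileFun (ν : Measure ℝ≥0∞) (s : ℝ) : ℝ≥0∞ :=
  sInf {y | ENNReal.ofReal s ≤ ν (Iic y)}

section quantileFun

variable (ν : Measure ℝ≥0∞)

theorem monotone_quantileFun : Monotone (quantileFun ν) := fun _ _ hst =>
  sInf_le_sInf fun _ hy => (ENNReal.ofReal_le_ofReal hst).trans hy

variable [IsProbabilityMeasure ν]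

/-- The infimum is attained because `y ↦ ν [0,y]` is right-continuous. If the quantile is infinite,
attainment is `s ≤ 1 = ν [0,∞]`. -/
theorem quantileFun_le_iff {s : ℝ} (hs : s ≤ 1) (y : ℝ≥0∞) :
    quantileFun ν s ≤ y ↔ ENNReal.ofReal s ≤ ν (Iic y) := by
  refine ⟨fun hy => ?_, fun hy => sInf_le hy⟩
  suffices hq : ENNReal.ofReal s ≤ ν (Iic (quantileFun ν s)) from
    hq.trans (measure_mono (Iic_subset_Iic.2 hy))
  rcases eq_or_ne (quantileFun ν s) ⊤ with htop | htop
  · rw [htop, Iic_top, measure_univ]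
    exact ENNReal.ofReal_le_one.2 hs
  have hlim : Tendsto (ν ∘ Iic) (𝓝[>] (quantileFun ν s))
      (𝓝 (ν (⋂ r, ⋂ (_ : r > quantileFun ν s), Iic r))) :=
    tendsto_measure_biInter_gt (fun r _ => measurableSet_Iic.nullMeasurableSet)
      (fun i j _ hij => Iic_subset_Iic.2 hij)
      ⟨⊤, lt_top_iff_ne_top.2 htop, measure_ne_top _ _⟩
  have hinter : ⋂ r, ⋂ (_ : r > quantileFun ν s), Iic r = Iic (quantileFun ν s) := by
    ext x
    simp only [mem_iInter, mem_Iic]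
    exact ⟨fun hx => le_of_forall_gt_imp_ge_of_dense hx, fun hx r hr => hx.trans hr.le⟩
  rw [hinter] at hlim
  have : (𝓝[>] (quantileFun ν s)).NeBot :=
    nhdsGT_neBot_of_exists_gt ⟨⊤, lt_top_iff_ne_top.2 htop⟩
  refine ge_of_tendsto hlim ?_
  filter_upwards [self_mem_nhdsWithin] with r hr
  obtain ⟨y', hy', hyr⟩ := sInf_lt_iff.1 (show sInf {y | ENNReal.ofReal s ≤ ν (Iic y)} < r from hr)
  exact le_trans hy' (measure_mono (Iic_subset_Iic.2 hyr.le))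

/-- Inverse transform sampling: sublevel sets of the quantile function in `[0,1]` are intervals `[0,
ν [0,y]]`. -/
theorem map_quantileFun : (volume.restrict (Icc (0 : ℝ) 1)).map (quantileFun ν) = ν := by
  refine (Measure.ext_of_Iic _ _ fun y => ?_).symm
  rw [Measure.map_apply (monotone_quantileFun ν).measurable measurableSet_Iic,
    Measure.restrict_apply ((monotone_quantileFun ν).measurable measurableSet_Iic)]
  have hset : quantileFun ν ⁻¹' Iic y ∩ Icc 0 1 = Icc 0 (ν.real (Iic y)) := by
    ext s
    simp only [mem_inter_iff, mem_preimage, mem_Iic, mem_Icc]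
    constructor
    · rintro ⟨h1, h2, h3⟩
      rw [quantileFun_le_iff ν h3] at h1
      exact ⟨h2, (ENNReal.ofReal_le_iff_le_toReal (measure_ne_top _ _)).1 h1⟩
    · rintro ⟨h1, h2⟩
      have h3 : s ≤ 1 := h2.trans measureReal_le_one
      exact ⟨(quantileFun_le_iff ν h3 y).2
        ((ENNReal.ofReal_le_iff_le_toReal (measure_ne_top _ _)).2 h2), h1, h3⟩
  rw [hset, Real.volume_Icc, sub_zero, ofReal_measureReal]

theorem lintegral_quantileFun {Φ : ℝ≥0∞ → ℝ≥0∞} (hΦ : Measurable Φ) :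
    ∫⁻ s in Icc (0 : ℝ) 1, Φ (quantileFun ν s) = ∫⁻ y, Φ y ∂ν := by
  conv_rhs => rw [← map_quantileFun ν]
  rw [lintegral_map hΦ (monotone_quantileFun ν).measurable]

/-- The tail integral of the quantile function at `a` is at least the value of
`λ (1 - a) + ∫ (y - λ)₊ dν` at some `λ`. -/
theorem exists_le_lintegral_quantileFun {a : ℝ} (ha : a ∈ Ico (0 : ℝ) 1) :
    ∃ l : ℝ≥0, l * ENNReal.ofReal (1 - a) + ∫⁻ y, (y - l) ∂ν
      ≤ ∫⁻ s in Icc a 1, quantileFun ν s := by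
  have hq := (monotone_quantileFun ν).measurable
  rcases eq_or_ne (quantileFun ν a) ⊤ with htop | htop
  · have : ∫⁻ s in Icc a 1, quantileFun ν s = ⊤ := by
      rw [setLIntegral_congr_fun (g := fun _ => ⊤) measurableSet_Icc, setLIntegral_const,
        Real.volume_Icc, ENNReal.top_mul]
      · simpa using ha.2
      · intro s hs
        exact top_le_iff.1 (htop ▸ monotone_quantileFun ν hs.1)
    exact ⟨0, this ▸ le_top⟩
  -- At the level `λ = q(a)`, monotonicity makes `(q - λ)₊` vanish to the left of `a` and equal `q -
  -- λ` to the right.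
  refine ⟨(quantileFun ν a).toNNReal, ?_⟩
  rw [ENNReal.coe_toNNReal htop]
  set l := quantileFun ν a with hl
  have h1 : ∫⁻ y, (y - l) ∂ν = ∫⁻ s in Icc a 1, (quantileFun ν s - l) := by
    rw [← lintegral_quantileFun ν (by fun_prop : Measurable fun y => y - l)]
    have : Icc a 1 = Icc a 1 ∩ Icc 0 1 :=
      (inter_eq_self_of_subset_left (Icc_subset_Icc_left ha.1)).symm
    rw [this, ← setLIntegral_indicator measurableSet_Icc]
    refine setLIntegral_congr_fun measurableSet_Icc fun s hs => ?_
    by_cases hsa : s ∈ Icc a 1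
    · rw [indicator_of_mem hsa]
    · rw [indicator_of_notMem hsa]
      refine tsub_eq_zero_of_le (monotone_quantileFun ν ?_)
      by_contra hc
      exact hsa ⟨(not_le.1 hc).le, hs.2⟩
  have h2 : l * ENNReal.ofReal (1 - a) = ∫⁻ s in Icc a 1, l := by
    rw [setLIntegral_const, Real.volume_Icc]
  rw [h1, h2, ← lintegral_add_left measurable_const]
  refine setLIntegral_mono' measurableSet_Icc fun s hs => ?_
  rw [add_tsub_cancel_of_le (monotone_quantileFun ν hs.1)]

end quantileFun

/-! ### The power weight -/

theorem lintegral_power_weight {m : ℕ} (hm : 0 < m) {s : ℝ} (hs : 0 ≤ s) :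
    ∫⁻ a in Icc 0 s, ENNReal.ofReal (m * a ^ (m - 1)) = ENNReal.ofReal s ^ m := by
  have hc : ContinuousOn (fun a : ℝ => (m : ℝ) * a ^ (m - 1)) (Icc 0 s) := by fun_prop
  rw [← ofReal_integral_eq_lintegral_ofReal hc.integrableOn_Icc, integral_Icc_eq_integral_Ioc,
    ← intervalIntegral.integral_of_le hs, intervalIntegral.integral_const_mul, integral_pow,
    ← ENNReal.ofReal_pow hs]
  · obtain ⟨k, rfl⟩ := Nat.exists_eq_succ_of_ne_zero hm.ne'
    congr 1
    simp
    field_simp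
  · filter_upwards [ae_restrict_mem measurableSet_Icc] with a ha
    have := ha.1
    simp only [Pi.zero_apply]
    positivity

/-- Write `s^m` as the integral of `m a^(m-1)` over `[0,s]` and exchange: the integral becomes a
weighted average of tail integrals, the quantities that feasibility controls. -/
theorem lintegral_mul_pow {m : ℕ} (hm : 0 < m) {q : ℝ → ℝ≥0∞} (hq : Measurable q) :
    ∫⁻ s in Icc (0 : ℝ) 1, q s * ENNReal.ofReal s ^ m
      = ∫⁻ a in Icc (0 : ℝ) 1, ENNReal.ofReal (m * a ^ (m - 1)) * ∫⁻ s in Icc a 1, q s := by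
  have h1 := lintegral_Icc_lintegral_Icc (volume.withDensity q)
    (k := fun a => ENNReal.ofReal (m * a ^ (m - 1))) (by fun_prop)
  have h2 : ∀ a, volume.withDensity q (Icc a 1) = ∫⁻ s in Icc a 1, q s :=
    fun a => withDensity_apply _ measurableSet_Icc
  simp_rw [h2] at h1
  rw [← h1, setLIntegral_congr_fun (g := fun x => ENNReal.ofReal x ^ m) measurableSet_Icc
    fun x hx => lintegral_power_weight hm hx.1, restrict_withDensity measurableSet_Icc,
    lintegral_withDensity_eq_lintegral_mul _ hq (by fun_prop)]
  rfl

/-! ### The lower bound for the objective -/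

theorem monotone_legendre (φ : ℝ≥0 → ℝ≥0∞) : Monotone (legendre φ) := fun _ _ hxy =>
  iSup_mono fun _ => tsub_le_tsub_right (mul_le_mul_right hxy _) _

/-- Young's inequality. -/
theorem mul_le_legendre_add (φ : ℝ≥0 → ℝ≥0∞) (z : ℝ≥0) (y : ℝ≥0∞) :
    z * y ≤ legendre φ y + φ z :=
  tsub_le_iff_right.1 (le_iSup (fun x : ℝ≥0 => (x : ℝ≥0∞) * y - φ x) z)

/-- The optimal value of the dual problem. -/
noncomputable def minValue (ρ : ℝ → ℝ) (m : ℕ) : ℝ≥0∞ :=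
  ∫⁻ a in Icc (0 : ℝ) 1, ENNReal.ofReal (m * a ^ (m - 1)) * ENNReal.ofReal (ironedCurve ρ a)

/-- The total mass of the singular part of a measure on the unit interval. -/
noncomputable def singularMass (ρ : ℝ → ℝ) (ς : Measure ℝ) : ℝ≥0∞ :=
  ς.singularPart (valueDist ρ) (Icc 0 1)

/-- The law of the density of the absolutely continuous part of a measure. -/
noncomputable def densityLaw (ρ : ℝ → ℝ) (ς : Measure ℝ) : Measure ℝ≥0∞ :=
  (valueDist ρ).map (ς.rnDeriv (valueDist ρ))

theorem lintegral_densityLaw {ρ : ℝ → ℝ} {ς : Measure ℝ} {Φ : ℝ≥0∞ → ℝ≥0∞} (hΦ : Measurable Φ) :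
    ∫⁻ y, Φ y ∂(densityLaw ρ ς) = ∫⁻ x, Φ (ς.rnDeriv (valueDist ρ) x) ∂(valueDist ρ) :=
  lintegral_map hΦ (Measure.measurable_rnDeriv _ _)

namespace IsDensity

variable {ρ : ℝ → ℝ}

theorem isProbabilityMeasure_densityLaw (h : IsDensity ρ) (ς : Measure ℝ) :
    IsProbabilityMeasure (densityLaw ρ ς) := by
  have := h.isProbabilityMeasure
  exact Measure.isProbabilityMeasure_map (Measure.measurable_rnDeriv _ _).aemeasurable

/-- If the curve of the virtual valuation lies below `S + ∫_[Q(t),1] f dμ`, then the ironed curve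
lies below the affine functions `S + λ (1 - t) + ∫ (f - λ)₊ dμ`. -/
theorem ofReal_ironedCurve_le (h : IsDensity ρ) {S : ℝ≥0∞} {f : ℝ → ℝ≥0∞}
    (hle : ∀ a ∈ Icc (0 : ℝ) 1, ENNReal.ofReal (a * (1 - distFun ρ a))
      ≤ S + ∫⁻ x in Icc a 1, f x ∂(valueDist ρ)) (l : ℝ≥0) {t : ℝ} (ht : t ∈ Icc (0 : ℝ) 1) :
    ENNReal.ofReal (ironedCurve ρ t)
      ≤ S + (l * ENNReal.ofReal (1 - t) + ∫⁻ x, (f x - l) ∂(valueDist ρ)) := by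
  set C := S + ∫⁻ x, (f x - l) ∂(valueDist ρ) with hC
  have hrw : ∀ r : ℝ≥0∞, S + (r + ∫⁻ x, (f x - l) ∂(valueDist ρ)) = C + r := fun r => by
    rw [hC]; ring
  rw [hrw]
  -- Majorants are real-valued, so an infinite constant is set aside first.
  rcases eq_or_ne C ⊤ with hCtop | hCtop
  · simp [hCtop]
  have hbound : ∀ s ∈ Icc (0 : ℝ) 1, C + l * ENNReal.ofReal (1 - s)
      = ENNReal.ofReal (C.toReal + l * (1 - s)) := by
    intro s hs
    rw [ENNReal.ofReal_add ENNReal.toReal_nonneg (mul_nonneg l.coe_nonneg (by linarith [hs.2])),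
      ENNReal.ofReal_toReal hCtop, ENNReal.ofReal_mul l.coe_nonneg, ENNReal.ofReal_coe_nnreal]
  -- The majorant property comes from `f ≤ (f - λ)₊ + λ` on `[Q(s),1]`, a set of mass `1 - s`.
  have hmaj : IsMajorant (curve ρ (virtualValue ρ)) (fun s => C.toReal + l * (1 - s)) := by
    refine ⟨?_, ?_, ?_, ?_⟩
    · exact ⟨convex_Icc 0 1, fun x _ y _ a b _ _ hab => le_of_eq <| by
        simp only [smul_eq_mul]
        linear_combination (C.toReal + l) * hab⟩
    · intro x _ y _ hxy
      have := l.coe_nonneg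
      simp only
      gcongr
    · intro s hs
      have := sub_nonneg.2 hs.2
      positivity
    · intro s hs
      have h0 : 0 ≤ C.toReal + l * (1 - s) := by
        have := sub_nonneg.2 hs.2
        positivity
      rw [h.curve_virtualValue hs, ← ENNReal.ofReal_le_ofReal_iff h0, ← hbound s hs]
      have h1 := hle _ (h.quantile_mem hs)
      rw [h.distFun_quantile hs] at h1
      refine h1.trans ?_
      have h2 : ∫⁻ x in Icc (quantile ρ s) 1, f x ∂(valueDist ρ)
          ≤ ∫⁻ x, (f x - l) ∂(valueDist ρ) + l * ENNReal.ofReal (1 - s) := by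
        calc ∫⁻ x in Icc (quantile ρ s) 1, f x ∂(valueDist ρ)
            ≤ ∫⁻ x in Icc (quantile ρ s) 1, ((f x - l) + l) ∂(valueDist ρ) :=
              lintegral_mono fun x => le_tsub_add
          _ = ∫⁻ x in Icc (quantile ρ s) 1, (f x - l) ∂(valueDist ρ)
              + l * ENNReal.ofReal (1 - s) := by
              rw [lintegral_add_right _ measurable_const, setLIntegral_const,
                h.valueDist_Icc (h.quantile_mem hs) (by simp) (h.quantile_mem hs).2,
                h.distFun_one, h.distFun_quantile hs]
          _ ≤ _ := by gcongr; exact Measure.restrict_le_self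
      rw [hC, add_assoc]
      gcongr
  rw [hbound t ht]
  exact ENNReal.ofReal_le_ofReal (hmaj.envelope_le ht)

/-- The singular mass of `[a,1]` is replaced by the total one, a constant that can be absorbed into
an affine majorant. -/
theorem le_add_setLIntegral_of_isFeasible (h : IsDensity ρ) {ς : Measure ℝ}
    (hς : IsFeasible ρ ς) {a : ℝ} (ha : a ∈ Icc (0 : ℝ) 1) :
    ENNReal.ofReal (a * (1 - distFun ρ a)) ≤ singularMass ρ ς +
      ∫⁻ x in Icc a 1, ς.rnDeriv (valueDist ρ) x ∂(valueDist ρ) := by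
  have := hς.1.1
  have := h.isProbabilityMeasure
  refine (h.le_of_isFeasible hς ha).trans ?_
  conv_lhs => rw [← Measure.singularPart_add_rnDeriv ς (valueDist ρ)]
  rw [Measure.add_apply, withDensity_apply _ measurableSet_Icc]
  gcongr
  exact measure_mono (Icc_subset_Icc_left ha.1)

/-- The tail integrals of the rearranged density of a feasible measure dominate the ironed
curve. -/
theorem ofReal_ironedCurve_le_quantileFun (h : IsDensity ρ) {ς : Measure ℝ}
    (hς : IsFeasible ρ ς) {a : ℝ} (ha : a ∈ Icc (0 : ℝ) 1) :
    ENNReal.ofReal (ironedCurve ρ a)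
      ≤ singularMass ρ ς + ∫⁻ s in Icc a 1, quantileFun (densityLaw ρ ς) s := by
  have := h.isProbabilityMeasure_densityLaw ς
  rcases ha.2.eq_or_lt with rfl | ha1
  · simp [h.ironedCurve_one]
  obtain ⟨l, hl⟩ := exists_le_lintegral_quantileFun (densityLaw ρ ς) ⟨ha.1, ha1⟩
  rw [lintegral_densityLaw (by fun_prop)] at hl
  exact (h.ofReal_ironedCurve_le (fun b hb => h.le_add_setLIntegral_of_isFeasible hς hb) l
    ha).trans (by gcongr)

/-- The weight `m a^(m-1)` has total mass one, so the constant moves under the integral. -/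
theorem rearranged_eq {m : ℕ} (hm : 0 < m) (ς : Measure ℝ) :
    singularMass ρ ς + ∫⁻ s in Icc (0 : ℝ) 1,
        quantileFun (densityLaw ρ ς) s * ENNReal.ofReal s ^ m
      = ∫⁻ a in Icc (0 : ℝ) 1, ENNReal.ofReal (m * a ^ (m - 1)) *
        (singularMass ρ ς + ∫⁻ s in Icc a 1, quantileFun (densityLaw ρ ς) s) := by
  simp_rw [mul_add]
  rw [lintegral_mul_pow hm (monotone_quantileFun _).measurable, lintegral_add_left (by fun_prop),
    lintegral_mul_const _ (by fun_prop), lintegral_power_weight hm zero_le_one]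
  simp

theorem minValue_le_rearranged (h : IsDensity ρ) {m : ℕ} (hm : 0 < m) {ς : Measure ℝ}
    (hς : IsFeasible ρ ς) :
    minValue ρ m ≤ singularMass ρ ς + ∫⁻ s in Icc (0 : ℝ) 1,
        quantileFun (densityLaw ρ ς) s * ENNReal.ofReal s ^ m := by
  rw [rearranged_eq hm ς]
  refine setLIntegral_mono' measurableSet_Icc fun a ha => ?_
  gcongr
  exact h.ofReal_ironedCurve_le_quantileFun hς ha

/-- The Legendre term depends only on the law of the density, so the density may be replaced by its
rearrangement; then Young's inequality is applied at `s^(B-1)`. -/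
theorem rearranged_le_objective (h : IsDensity ρ) {B : ℕ} (ς : Measure ℝ)
    (φ : ℝ≥0 → ℝ≥0∞) :
    singularMass ρ ς + ∫⁻ s in Icc (0 : ℝ) 1,
        quantileFun (densityLaw ρ ς) s * ENNReal.ofReal s ^ (B - 1) ≤ objective ρ B ς φ := by
  have := h.isProbabilityMeasure_densityLaw ς
  have hmeas := (monotone_legendre φ).measurable
  rw [objective, add_assoc, ← lintegral_densityLaw hmeas, ← lintegral_quantileFun _ hmeas,
    ← lintegral_add_left (show Measurable fun s => legendre φ (quantileFun (densityLaw ρ ς) s) from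
      hmeas.comp (monotone_quantileFun _).measurable), singularMass]
  refine add_le_add_right (lintegral_mono fun s => ?_) _
  refine le_of_eq_of_le ?_ (mul_le_legendre_add φ (s.toNNReal ^ (B - 1)) _)
  rw [mul_comm, ENNReal.coe_pow]
  rfl

theorem minValue_le_objective (h : IsDensity ρ) {B : ℕ} (hB : 1 < B) {ς : Measure ℝ}
    (hς : IsFeasible ρ ς) (φ : ℝ≥0 → ℝ≥0∞) :
    minValue ρ (B - 1) ≤ objective ρ B ς φ :=
  (h.minValue_le_rearranged (by omega) hς).trans (h.rearranged_le_objective ς φ)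

end IsDensity

/-! ### Conjugate functions and an optimal pair -/

/-- Equality in Young's inequality characterizes subgradients. -/
theorem legendre_add_eq_iff {φ : ℝ≥0 → ℝ≥0∞} (h0 : φ 0 = 0) (w y : ℝ≥0) :
    legendre φ y + φ w = w * y ↔ IsSubgradient φ w y := by
  constructor
  · intro heq
    have hfin : φ w ≠ ⊤ := by
      refine ne_top_of_le_ne_top (b := (w : ℝ≥0∞) * y) (by finiteness) ?_
      rw [← heq]
      exact le_add_self
    refine ⟨hfin, fun z => ?_⟩
    have hL : legendre φ y ≠ ⊤ := by
      refine ne_top_of_le_ne_top (b := (w : ℝ≥0∞) * y) (by finiteness) ?_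
      rw [← heq]
      exact le_self_add
    rw [← ENNReal.add_le_add_iff_left hL, ← add_assoc, heq]
    calc (w : ℝ≥0∞) * y + y * z = z * y + y * w := by ring
      _ ≤ (legendre φ y + φ z) + y * w := by gcongr; exact mul_le_legendre_add φ z y
      _ = _ := by ring
  · rintro ⟨hfin, hsub⟩
    refine le_antisymm ?_ (mul_le_legendre_add φ w y)
    -- The subgradient inequality at `z = 0`; it ensures that truncation does not spoil `w y -
    -- φ(w)`.
    have h1 : φ w ≤ w * y := by simpa [h0, mul_comm] using hsub 0
    rw [← tsub_add_cancel_of_le h1]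
    gcongr
    refine iSup_le fun z => ENNReal.le_sub_of_add_le_right hfin ?_
    rcases le_total ((z : ℝ≥0∞) * y) (φ z) with hz | hz
    · rwa [tsub_eq_zero_of_le hz, zero_add]
    · have hfz : φ z ≠ ⊤ := ne_top_of_le_ne_top (by finiteness) hz
      rw [← ENNReal.add_le_add_iff_right hfz]
      calc (z : ℝ≥0∞) * y - φ z + φ w + φ z = (z * y - φ z + φ z) + φ w := by ring
        _ = z * y + φ w := by rw [tsub_add_cancel_of_le hz]
        _ ≤ φ z + y * w := by rw [add_comm, mul_comm (z : ℝ≥0∞)]; exact hsub z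
        _ = w * y + φ z := by ring

/-- A supremum of non-decreasing convex functions, truncated affine ones, each zero at `0`. -/
theorem isAdmissible_legendre {ψ : ℝ≥0 → ℝ≥0∞} :
    IsAdmissible fun z => legendre ψ z where
  convex := by
    refine ⟨convex_univ, fun z _ z' _ a b _ _ hab => iSup_le fun y => ?_⟩
    rw [tsub_le_iff_right]
    have hab' : (a : ℝ≥0∞) + b = 1 := by exact_mod_cast hab
    have h1 := mul_le_legendre_add ψ y z
    have h2 := mul_le_legendre_add ψ y z'
    simp only [ENNReal.smul_def, smul_eq_mul, ENNReal.coe_add, ENNReal.coe_mul]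
    calc (y : ℝ≥0∞) * (a * z + b * z') = a * (y * z) + b * (y * z') := by ring
      _ ≤ a * (legendre ψ z + ψ y) + b * (legendre ψ z' + ψ y) := by gcongr
      _ = a * legendre ψ z + b * legendre ψ z' + (a + b) * ψ y := by ring
      _ = _ := by rw [hab', one_mul]
  monotone := fun z z' hz => monotone_legendre ψ (by exact_mod_cast hz)
  zero := by simp [legendre]

theorem lowerSemicontinuous_legendre (ψ : ℝ≥0 → ℝ≥0∞) :
    LowerSemicontinuous fun z : ℝ≥0 => legendre ψ z := by
  refine lowerSemicontinuous_iSup fun y => Continuous.lowerSemicontinuous ?_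
  refine (ENNReal.continuous_sub_right (ψ y)).comp ?_
  simp_rw [← ENNReal.coe_mul]
  exact ENNReal.continuous_coe.comp (by fun_prop)

/-- `y z - ψ(y) ≥ y (z - 1)` is unbounded in `y`; to exceed `r` take `y = r / (z - 1)`. -/
theorem legendre_eq_top {ψ : ℝ≥0 → ℝ≥0∞} (hψ : ∀ y : ℝ≥0, ψ y ≤ y) {z : ℝ≥0} (hz : 1 < z) :
    legendre ψ z = ⊤ := by
  refine ENNReal.eq_top_of_forall_nnreal_le fun r => ?_
  have hz0 : z - 1 ≠ 0 := (tsub_pos_of_lt hz).ne'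
  refine le_trans ?_ (le_iSup (fun y : ℝ≥0 => (y : ℝ≥0∞) * z - ψ y) (r / (z - 1)))
  refine le_trans ?_ (tsub_le_tsub_left (hψ _) _)
  rw [← ENNReal.coe_mul, ← ENNReal.coe_sub, ENNReal.coe_le_coe]
  have h1 : r = r / (z - 1) * (z - 1) := (div_mul_cancel₀ r hz0).symm
  have h2 : r / (z - 1) * z - r / (z - 1) = r / (z - 1) * (z - 1) := by rw [mul_tsub, mul_one]
  rw [h2, ← h1]

/-- The measure with the ironed virtual valuation as its density. -/
noncomputable def ironedMeasure (ρ : ℝ → ℝ) : Measure ℝ :=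
  (valueDist ρ).withDensity fun x => ENNReal.ofReal (ironedValue ρ x)

/-- The conjugate of the optimal `φ`. -/
noncomputable def optimalConjugate (ρ : ℝ → ℝ) (m : ℕ) (y : ℝ≥0) : ℝ≥0∞ :=
  -- Its slope at `y` is the `m t^(m-1) dt` mass of `{k < y}`; as `k` is monotone, this is `t^m` at
  -- the point where `k` crosses `y`. So the slopes invert the desired relation between `t^m` and
  -- `k(t)`.
  ∫⁻ t in Icc (0 : ℝ) 1, ENNReal.ofReal (m * t ^ (m - 1)) * (y - ENNReal.ofReal (ironedRate ρ t))

/-- The optimal `φ`, normalized to be lower semicontinuous and infinite beyond `1`. -/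
noncomputable def optimalPhi (ρ : ℝ → ℝ) (m : ℕ) (z : ℝ≥0) : ℝ≥0∞ :=
  legendre (optimalConjugate ρ m) z

theorem isAdmissible_optimalPhi (ρ : ℝ → ℝ) (m : ℕ) : IsAdmissible (optimalPhi ρ m) :=
  isAdmissible_legendre

theorem optimalConjugate_le (ρ : ℝ → ℝ) {m : ℕ} (hm : 0 < m) (y : ℝ≥0) :
    optimalConjugate ρ m y ≤ y := by
  calc optimalConjugate ρ m y
      ≤ ∫⁻ t in Icc (0 : ℝ) 1, ENNReal.ofReal (m * t ^ (m - 1)) * y :=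
        lintegral_mono fun t => mul_le_mul_right tsub_le_self _
    _ = y := by
        rw [lintegral_mul_const _ (by fun_prop), lintegral_power_weight hm zero_le_one]
        simp

namespace IsDensity

variable {ρ : ℝ → ℝ}

theorem measurable_ofReal_ironedRate (h : IsDensity ρ) :
    Measurable fun s => ENNReal.ofReal (ironedRate ρ s) :=
  h.monotone_ironedRate.measurable.ennreal_ofReal

theorem ofReal_ironedCurve_Icc (h : IsDensity ρ) {t : ℝ} (ht : t ∈ Icc (0 : ℝ) 1) :
    ENNReal.ofReal (ironedCurve ρ t) = ∫⁻ s in Icc t 1, ENNReal.ofReal (ironedRate ρ s) := by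
  rw [h.ofReal_ironedCurve ht, restrict_Ioc_eq_restrict_Icc]

theorem minValue_eq (h : IsDensity ρ) {m : ℕ} (hm : 0 < m) :
    minValue ρ m
      = ∫⁻ s in Icc (0 : ℝ) 1, ENNReal.ofReal (ironedRate ρ s) * ENNReal.ofReal s ^ m := by
  rw [minValue, lintegral_mul_pow hm h.measurable_ofReal_ironedRate]
  exact setLIntegral_congr_fun measurableSet_Icc fun a ha => by rw [h.ofReal_ironedCurve_Icc ha]

theorem minValue_ne_top (h : IsDensity ρ) {m : ℕ} (hm : 0 < m) : minValue ρ m ≠ ⊤ := by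
  rw [h.minValue_eq hm]
  refine ne_top_of_le_ne_top ENNReal.one_ne_top ?_
  calc _ ≤ ∫⁻ s in Icc (0 : ℝ) 1, 1 := by
        refine setLIntegral_mono' measurableSet_Icc fun s hs => ?_
        exact mul_le_one' (ENNReal.ofReal_le_one.2 (h.ironedRate_mem s).2)
          (pow_le_one' (ENNReal.ofReal_le_one.2 hs.2) _)
    _ = 1 := by simp

theorem ae_ofReal_ironedValue (h : IsDensity ρ) :
    (fun x => ENNReal.ofReal (ironedValue ρ x)) =ᵐ[valueDist ρ]
      fun x => ENNReal.ofReal (ironedRate ρ (distFun ρ x)) := by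
  filter_upwards [h.ae_ironedValue] with x hx
  rw [hx.2]

theorem aemeasurable_ofReal_ironedValue (h : IsDensity ρ) :
    AEMeasurable (fun x => ENNReal.ofReal (ironedValue ρ x)) (valueDist ρ) :=
  (h.measurable_ofReal_ironedRate.comp_aemeasurable h.aemeasurable_distFun).congr
    h.ae_ofReal_ironedValue.symm

theorem setLIntegral_ironedValue (h : IsDensity ρ) {a : ℝ} (ha : a ∈ Icc (0 : ℝ) 1) :
    ∫⁻ x in Icc a 1, ENNReal.ofReal (ironedValue ρ x) ∂(valueDist ρ)
      = ENNReal.ofReal (ironedCurve ρ (distFun ρ a)) := by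
  rw [lintegral_congr_ae (ae_restrict_of_ae h.ae_ofReal_ironedValue),
    h.setLIntegral_distFun h.measurable_ofReal_ironedRate ha,
    h.ofReal_ironedCurve_Icc (h.distFun_mem ha)]

theorem ironedMeasure_Icc (h : IsDensity ρ) {a : ℝ} (ha : a ∈ Icc (0 : ℝ) 1) :
    ironedMeasure ρ (Icc a 1) = ENNReal.ofReal (ironedCurve ρ (distFun ρ a)) := by
  rw [ironedMeasure, withDensity_apply _ measurableSet_Icc, h.setLIntegral_ironedValue ha]

theorem le_setLIntegral_ironedValue (h : IsDensity ρ) {a : ℝ} (ha : a ∈ Icc (0 : ℝ) 1) :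
    ENNReal.ofReal (a * (1 - distFun ρ a))
      ≤ ∫⁻ x in Icc a 1, ENNReal.ofReal (ironedValue ρ x) ∂(valueDist ρ) := by
  rw [h.setLIntegral_ironedValue ha]
  refine ENNReal.ofReal_le_ofReal ?_
  have := h.isMajorant_ironedCurve.le _ (h.distFun_mem ha)
  rwa [h.curve_virtualValue (h.distFun_mem ha), h.quantile_distFun ha] at this

theorem isMeasureOnUnit_ironedMeasure (h : IsDensity ρ) : IsMeasureOnUnit (ironedMeasure ρ) := by
  have hnull : ironedMeasure ρ (Icc 0 1)ᶜ = 0 :=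
    withDensity_absolutelyContinuous _ _ (ae_mem ρ)
  refine ⟨⟨?_⟩, hnull⟩
  rw [← measure_inter_add_sdiff univ measurableSet_Icc, univ_inter, ← compl_eq_univ_sdiff, hnull,
    add_zero, h.ironedMeasure_Icc (by simp)]
  exact ENNReal.ofReal_lt_top

theorem isFeasible_ironedMeasure (h : IsDensity ρ) : IsFeasible ρ (ironedMeasure ρ) := by
  refine h.isFeasible_of_le h.isMeasureOnUnit_ironedMeasure fun a ha => ?_
  rw [ironedMeasure, withDensity_apply _ measurableSet_Icc]
  exact h.le_setLIntegral_ironedValue ha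

theorem rnDeriv_ironedMeasure (h : IsDensity ρ) :
    (ironedMeasure ρ).rnDeriv (valueDist ρ) =ᵐ[valueDist ρ]
      fun x => ENNReal.ofReal (ironedValue ρ x) := by
  have := h.isProbabilityMeasure
  exact Measure.rnDeriv_withDensity₀ _ h.aemeasurable_ofReal_ironedValue

/-- There is no singular part, and the density is a function of the uniform variable `P(x)`, so both
integrals of the objective live on the same interval and can be compared pointwise. -/
theorem objective_ironedMeasure (h : IsDensity ρ) (B : ℕ) (φ : ℝ≥0 → ℝ≥0∞) :
    objective ρ B (ironedMeasure ρ) φ = ∫⁻ s in Icc (0 : ℝ) 1,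
      (legendre φ (ENNReal.ofReal (ironedRate ρ s)) + φ (s.toNNReal ^ (B - 1))) := by
  have hmeas : Measurable fun s => legendre φ (ENNReal.ofReal (ironedRate ρ s)) :=
    (monotone_legendre φ).measurable.comp h.measurable_ofReal_ironedRate
  rw [lintegral_add_left hmeas, ← h.lintegral_distFun hmeas, objective, ironedMeasure,
    Measure.singularPart_withDensity, Measure.coe_zero, Pi.zero_apply, zero_add, ← ironedMeasure]
  congr 1
  refine lintegral_congr_ae ?_
  filter_upwards [h.rnDeriv_ironedMeasure, h.ae_ofReal_ironedValue] with x h1 h2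
  rw [h1, h2]

/-- The optimality condition: equality in Young's inequality almost everywhere. -/
theorem objective_le_minValue_iff (h : IsDensity ρ) {B : ℕ} (hB : 1 < B) {φ : ℝ≥0 → ℝ≥0∞}
    (hφ : IsAdmissible φ) :
    objective ρ B (ironedMeasure ρ) φ ≤ minValue ρ (B - 1) ↔
      ∀ᵐ s ∂(volume.restrict (Icc (0 : ℝ) 1)),
        IsSubgradient φ (s.toNNReal ^ (B - 1)) (ironedRate ρ s).toNNReal := by
  have hm : 0 < B - 1 := by omega
  have hiff : ∀ s : ℝ, IsSubgradient φ (s.toNNReal ^ (B - 1)) (ironedRate ρ s).toNNReal ↔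
      ENNReal.ofReal (ironedRate ρ s) * ENNReal.ofReal s ^ (B - 1)
        = legendre φ (ENNReal.ofReal (ironedRate ρ s)) + φ (s.toNNReal ^ (B - 1)) := by
    intro s
    rw [← legendre_add_eq_iff hφ.zero, eq_comm, mul_comm, ENNReal.coe_pow]
    rfl
  have hle : ∀ s : ℝ, ENNReal.ofReal (ironedRate ρ s) * ENNReal.ofReal s ^ (B - 1)
      ≤ legendre φ (ENNReal.ofReal (ironedRate ρ s)) + φ (s.toNNReal ^ (B - 1)) := by
    intro s
    refine le_of_eq_of_le ?_ (mul_le_legendre_add φ (s.toNNReal ^ (B - 1)) _)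
    rw [mul_comm, ENNReal.coe_pow]
    rfl
  simp_rw [hiff]
  rw [h.objective_ironedMeasure B φ, h.minValue_eq hm]
  constructor
  · intro hobj
    -- Young's inequality holds pointwise, and finite equal integrals leave no room for strictness.
    refine ae_eq_of_ae_le_of_lintegral_le (.of_forall hle) ?_ ?_ hobj
    · rw [← h.minValue_eq hm]; exact h.minValue_ne_top hm
    · refine Measurable.aemeasurable (Measurable.add ?_ ?_)
      · exact (monotone_legendre φ).measurable.comp h.measurable_ofReal_ironedRate
      · exact hφ.monotone.measurable.comp (by fun_prop)
  · intro hae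
    exact (lintegral_congr_ae hae).ge

/-- The rate of decrease of the ironed curve is a subgradient of the optimal `φ`. -/
theorem isSubgradient_optimalPhi (h : IsDensity ρ) {m : ℕ} (hm : 0 < m) {t : ℝ}
    (ht : t ∈ Icc (0 : ℝ) 1) :
    IsSubgradient (optimalPhi ρ m) (t.toNNReal ^ m) (ironedRate ρ t).toNNReal := by
  set W : ℝ → ℝ≥0∞ := fun s => ENNReal.ofReal (m * s ^ (m - 1)) with hW
  set k : ℝ → ℝ≥0∞ := fun s => ENNReal.ofReal (ironedRate ρ s) with hk
  set A := ∫⁻ s in Icc 0 t, W s * k s with hA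
  set w := t.toNNReal ^ m with hw
  have hkm : Measurable k := h.measurable_ofReal_ironedRate
  have hWm : Measurable W := by fun_prop
  have hwW : (w : ℝ≥0∞) = ∫⁻ s in Icc 0 t, W s := by
    rw [hW, lintegral_power_weight hm ht.1, hw, ENNReal.coe_pow]; rfl
  have hsub : Icc 0 t ⊆ Icc (0 : ℝ) 1 := Icc_subset_Icc_right ht.2
  -- Integrate `y ≤ k + (y - k)₊` against the weight over `[0,t]`; hence `φ(w) ≤ A`.
  have h1 : ∀ y : ℝ≥0, (y : ℝ≥0∞) * w ≤ A + optimalConjugate ρ m y := by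
    intro y
    rw [hwW, ← lintegral_const_mul _ hWm]
    calc ∫⁻ s in Icc 0 t, y * W s
        ≤ ∫⁻ s in Icc 0 t, (W s * k s + W s * (y - k s)) := by
          refine lintegral_mono fun s => ?_
          rw [← mul_add, mul_comm]
          gcongr
          exact le_add_tsub
      _ = A + ∫⁻ s in Icc 0 t, W s * (y - k s) := lintegral_add_left (by fun_prop) _
      _ ≤ A + optimalConjugate ρ m y := by
          gcongr
          exact lintegral_mono_set hsub
  -- For `y = k(t)` the bound is sharp: `k ≤ k(t)` on `[0,t]`, and the truncation vanishes beyond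
  -- `t`.
  have h2 : A + optimalConjugate ρ m (ironedRate ρ t).toNNReal
      = (ironedRate ρ t).toNNReal * w := by
    have h3 : optimalConjugate ρ m (ironedRate ρ t).toNNReal
        = ∫⁻ s in Icc 0 t, W s * (k t - k s) := by
      rw [optimalConjugate, ← inter_eq_self_of_subset_left hsub,
        ← setLIntegral_indicator measurableSet_Icc]
      refine setLIntegral_congr_fun measurableSet_Icc fun s hs => ?_
      by_cases hst : s ∈ Icc 0 t
      · rw [indicator_of_mem hst]; rfl
      · rw [indicator_of_notMem hst]
        have hts : t ≤ s := by
          by_contra hc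
          exact hst ⟨hs.1, (not_le.1 hc).le⟩
        have : ((ironedRate ρ t).toNNReal : ℝ≥0∞) - k s = 0 :=
          tsub_eq_zero_of_le (ENNReal.ofReal_le_ofReal (h.monotone_ironedRate hts))
        exact mul_eq_zero.2 (Or.inr this)
    rw [h3, hA, ← lintegral_add_left (by fun_prop), hwW, ← lintegral_const_mul _ hWm]
    refine setLIntegral_congr_fun measurableSet_Icc fun s hs => ?_
    rw [← mul_add, add_tsub_cancel_of_le
      (ENNReal.ofReal_le_ofReal (h.monotone_ironedRate hs.2)), mul_comm]
    rfl
  have h4 : optimalPhi ρ m w ≤ A := iSup_le fun y => tsub_le_iff_right.2 (h1 y)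
  refine ⟨ne_top_of_le_ne_top ?_ h4, fun z => ?_⟩
  · refine ne_top_of_le_ne_top (b := ((ironedRate ρ t).toNNReal : ℝ≥0∞) * w) (by finiteness) ?_
    rw [← h2]
    exact le_self_add
  · calc optimalPhi ρ m w + (ironedRate ρ t).toNNReal * z
        ≤ A + (optimalPhi ρ m z + optimalConjugate ρ m (ironedRate ρ t).toNNReal) := by
          gcongr
          exact mul_le_legendre_add _ _ _
      _ = optimalPhi ρ m z + (A + optimalConjugate ρ m (ironedRate ρ t).toNNReal) := by ring
      _ = _ := by rw [h2]

theorem objective_optimal (h : IsDensity ρ) {B : ℕ} (hB : 1 < B) :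
    objective ρ B (ironedMeasure ρ) (optimalPhi ρ (B - 1)) = minValue ρ (B - 1) := by
  refine le_antisymm ?_ (h.minValue_le_objective hB h.isFeasible_ironedMeasure _)
  rw [h.objective_le_minValue_iff hB (isAdmissible_optimalPhi _ _)]
  filter_upwards [ae_restrict_mem measurableSet_Icc] with s hs
  exact h.isSubgradient_optimalPhi (by omega) hs

theorem minValue_le_dualValue (h : IsDensity ρ) {B : ℕ} (hB : 1 < B) {ς : Measure ℝ}
    (hς : IsFeasible ρ ς) : minValue ρ (B - 1) ≤ dualValue ρ B ς :=
  le_iInf₂ fun φ _ => h.minValue_le_objective hB hς φ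

theorem dualValue_ironedMeasure (h : IsDensity ρ) {B : ℕ} (hB : 1 < B) :
    dualValue ρ B (ironedMeasure ρ) = minValue ρ (B - 1) :=
  le_antisymm ((iInf₂_le _ (isAdmissible_optimalPhi _ _)).trans (h.objective_optimal hB).le)
    (h.minValue_le_dualValue hB h.isFeasible_ironedMeasure)

theorem solvesDual_ironedMeasure (h : IsDensity ρ) {B : ℕ} (hB : 1 < B) :
    SolvesDual ρ B (ironedMeasure ρ) :=
  ⟨h.isFeasible_ironedMeasure, fun _ hς => (h.dualValue_ironedMeasure hB).le.trans
    (h.minValue_le_dualValue hB hς)⟩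

end IsDensity

/-! ### Uniqueness of the optimal measure -/

/-- A property that holds almost everywhere on `[0,1]` holds somewhere in each subinterval. -/
theorem exists_mem_Ioo_of_ae {p : ℝ → Prop}
    (hp : ∀ᵐ t ∂(volume.restrict (Icc (0 : ℝ) 1)), p t) {a b : ℝ} (ha : 0 ≤ a) (hab : a < b)
    (hb : b ≤ 1) : ∃ t ∈ Ioo a b, p t := by
  by_contra! hc
  rw [ae_restrict_iff' measurableSet_Icc] at hp
  have h1 : Ioo a b ⊆ {t | t ∈ Icc (0 : ℝ) 1 → p t}ᶜ := fun t ht hpt =>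
    hc t ht (hpt ⟨ha.trans ht.1.le, ht.2.le.trans hb⟩)
  have h2 := measure_mono_null h1 hp
  rw [Real.volume_Ioo, ENNReal.ofReal_eq_zero] at h2
  linarith

/-- If truncating at every level commutes with averaging, then the two numbers coincide. -/
theorem eq_of_forall_average_tsub {a b : ℝ≥0∞} (ha : a ≠ ⊤) (hb : b ≠ ⊤)
    (hab : ∀ r : ℚ, 2⁻¹ * a + 2⁻¹ * b - (Real.toNNReal r : ℝ≥0∞)
      = 2⁻¹ * (a - Real.toNNReal r) + 2⁻¹ * (b - Real.toNNReal r)) : a = b := by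
  wlog hlt : a < b generalizing a b
  · rcases (not_lt.1 hlt).eq_or_lt with heq | hlt'
    · exact heq.symm
    · exact (this hb ha (fun r => by rw [add_comm, hab r, add_comm]) hlt').symm
  -- A level strictly between `a` and `b` is where convexity of truncation is strict.
  obtain ⟨r, -, h1, h2⟩ := ENNReal.lt_iff_exists_rat_btwn.1 hlt
  have h3 := hab r
  lift a to ℝ≥0 using ha
  lift b to ℝ≥0 using hb
  generalize Real.toNNReal r = c at *
  have h2' : (2⁻¹ : ℝ≥0∞) = ((2⁻¹ : ℝ≥0) : ℝ≥0∞) := by simp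
  rw [h2'] at h3
  norm_cast at h1 h2 h3
  rw [tsub_eq_zero_of_le h1.le, mul_zero, zero_add] at h3
  have h4 : (0 : ℝ) < c - a := by simpa using h1
  have h5 : (0 : ℝ) < b - c := by simpa using h2
  have h6 := congrArg NNReal.toReal h3
  rw [NNReal.coe_sub_def, NNReal.coe_mul, NNReal.coe_sub h2.le] at h6
  push_cast at h6
  rcases max_cases ((2 : ℝ)⁻¹ * a + 2⁻¹ * b - c) 0 with h7 | h7 <;> linarith [h7.1]

namespace IsDensity

variable {ρ : ℝ → ℝ}

/-- A non-decreasing function whose tail integrals dominate the ironed curve, and agree with it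
almost everywhere, is the rate of decrease of the ironed curve. -/
theorem ae_eq_ironedRate (h : IsDensity ρ) {q : ℝ → ℝ≥0∞} (hq : Measurable q)
    (hle : ∀ a ∈ Icc (0 : ℝ) 1, ENNReal.ofReal (ironedCurve ρ a) ≤ ∫⁻ s in Icc a 1, q s)
    (hae : ∀ᵐ a ∂(volume.restrict (Icc (0 : ℝ) 1)),
      ∫⁻ s in Icc a 1, q s = ENNReal.ofReal (ironedCurve ρ a)) :
    q =ᵐ[volume.restrict (Icc (0 : ℝ) 1)] fun s => ENNReal.ofReal (ironedRate ρ s) := by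
  have heq : ∀ a ∈ Icc (0 : ℝ) 1,
      ∫⁻ s in Icc a 1, q s = ENNReal.ofReal (ironedCurve ρ a) := by
    intro a ha
    refine le_antisymm ?_ (hle a ha)
    rcases ha.2.eq_or_lt with rfl | ha1
    · simp
    -- To pass from almost every `a` to every `a`, exhaust `(a,1]` by intervals `[u n, 1]` and pick
    -- between `a` and `u n` a point where equality is known.
    obtain ⟨u, hu, hmem, hlim⟩ := exists_seq_strictAnti_tendsto' ha1
    have hunion : Ioc a 1 = ⋃ n, Icc (u n) 1 := by
      ext x
      simp only [mem_Ioc, mem_iUnion, mem_Icc]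
      constructor
      · rintro ⟨hax, hx1⟩
        obtain ⟨n, hn⟩ := (hlim.eventually_lt_const hax).exists
        exact ⟨n, hn.le, hx1⟩
      · rintro ⟨n, hn, hx1⟩
        exact ⟨(hmem n).1.trans_le hn, hx1⟩
    have hmono : Monotone fun n => Icc (u n) 1 :=
      fun i j hij => Icc_subset_Icc_left (hu.antitone hij)
    rw [← restrict_Ioc_eq_restrict_Icc, ← withDensity_apply _ measurableSet_Ioc, hunion,
      hmono.measure_iUnion]
    refine iSup_le fun n => ?_
    obtain ⟨b, hb, hbeq⟩ := exists_mem_Ioo_of_ae hae ha.1 (hmem n).1 (hmem n).2.le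
    have hb' : b ∈ Icc (0 : ℝ) 1 := ⟨ha.1.trans hb.1.le, hb.2.le.trans (hmem n).2.le⟩
    rw [withDensity_apply _ measurableSet_Icc]
    calc ∫⁻ s in Icc (u n) 1, q s ≤ ∫⁻ s in Icc b 1, q s :=
          lintegral_mono_set (Icc_subset_Icc_left hb.2.le)
      _ = ENNReal.ofReal (ironedCurve ρ b) := hbeq
      _ ≤ _ := ENNReal.ofReal_le_ofReal (h.isMajorant_ironedCurve.antitone ha hb' hb.1.le)
  have hfin : ∫⁻ s in Icc (0 : ℝ) 1, q s ≠ ⊤ := by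
    rw [heq 0 (by simp)]
    exact ENNReal.ofReal_ne_top
  rw [← withDensity_eq_iff hq.aemeasurable h.measurable_ofReal_ironedRate.aemeasurable hfin]
  have : IsFiniteMeasure ((volume.restrict (Icc (0 : ℝ) 1)).withDensity q) :=
    isFiniteMeasure_withDensity hfin
  have htail : ∀ (g : ℝ → ℝ≥0∞) (a : ℝ), (volume.restrict (Icc (0 : ℝ) 1)).withDensity g (Ici a)
      = ∫⁻ s in Icc (max a 0) 1, g s := by
    intro g a
    rw [withDensity_apply _ measurableSet_Ici, Measure.restrict_restrict measurableSet_Ici]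
    congr 2
    ext x
    simp [and_assoc]
  refine Measure.ext_of_Ici _ _ fun a => ?_
  rw [htail, htail]
  rcases le_or_gt a 1 with ha | ha
  · have hmem : max a 0 ∈ Icc (0 : ℝ) 1 := ⟨le_max_right _ _, max_le ha zero_le_one⟩
    rw [heq _ hmem, h.ofReal_ironedCurve_Icc hmem]
  · have : Icc (max a 0) 1 = ∅ := Icc_eq_empty (not_le.2 (lt_max_of_lt_left ha))
    simp [this]

/-- For each level there is a point at which the affine upper bound for the ironed curve is
attained. -/
theorem exists_ofReal_ironedCurve_eq (h : IsDensity ρ) (l : ℝ≥0) : ∃ t ∈ Icc (0 : ℝ) 1,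
    l * ENNReal.ofReal (1 - t) + ∫⁻ s in Icc (0 : ℝ) 1, (ENNReal.ofReal (ironedRate ρ s) - l)
      = ENNReal.ofReal (ironedCurve ρ t) := by
  -- The contact point is where `k` crosses the level `l`; inserting `0` covers the case that `k`
  -- exceeds `l` throughout.
  set T := insert 0 {s | s ∈ Icc (0 : ℝ) 1 ∧ ENNReal.ofReal (ironedRate ρ s) ≤ l} with hT
  have hTsub : T ⊆ Icc 0 1 := by
    rintro s (rfl | hs)
    · simp
    · exact hs.1
  have h0T : (0 : ℝ) ∈ T := mem_insert _ _
  have hbdd : BddAbove T := ⟨1, fun s hs => (hTsub hs).2⟩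
  set t := sSup T with ht
  have ht01 : t ∈ Icc (0 : ℝ) 1 := ⟨le_csSup hbdd h0T, csSup_le ⟨0, h0T⟩ fun s hs => (hTsub hs).2⟩
  have hlow : ∀ s ∈ Icc (0 : ℝ) 1, s < t → ENNReal.ofReal (ironedRate ρ s) ≤ l := by
    intro s hs hst
    obtain ⟨s', hs', hss'⟩ := exists_lt_of_lt_csSup ⟨0, h0T⟩ hst
    rcases hs' with rfl | hs'
    · exact absurd hss' (not_lt.2 hs.1)
    · exact (ENNReal.ofReal_le_ofReal (h.monotone_ironedRate hss'.le)).trans hs'.2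
  have hhigh : ∀ s ∈ Ioc t 1, (l : ℝ≥0∞) ≤ ENNReal.ofReal (ironedRate ρ s) := by
    intro s hs
    by_contra hc
    have : s ∈ T := Or.inr ⟨⟨ht01.1.trans hs.1.le, hs.2⟩, (not_le.1 hc).le⟩
    exact absurd (le_csSup hbdd this) (not_le.2 hs.1)
  refine ⟨t, ht01, ?_⟩
  have h1 : ∫⁻ s in Icc (0 : ℝ) 1, (ENNReal.ofReal (ironedRate ρ s) - l)
      = ∫⁻ s in Ioc t 1, (ENNReal.ofReal (ironedRate ρ s) - l) := by
    rw [restrict_Ioc_eq_restrict_Icc,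
      ← inter_eq_self_of_subset_left (Icc_subset_Icc_left ht01.1 : Icc t 1 ⊆ Icc (0 : ℝ) 1),
      ← setLIntegral_indicator measurableSet_Icc]
    refine setLIntegral_congr_fun measurableSet_Icc fun s hs => ?_
    by_cases hst : s ∈ Icc t 1
    · rw [indicator_of_mem hst]
    · rw [indicator_of_notMem hst]
      refine tsub_eq_zero_of_le (hlow s hs ?_)
      by_contra hc
      exact hst ⟨not_lt.1 hc, hs.2⟩
  have h2 : l * ENNReal.ofReal (1 - t) = ∫⁻ s in Ioc t 1, (l : ℝ≥0∞) := by
    rw [setLIntegral_const, Real.volume_Ioc]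
  rw [h1, h2, ← lintegral_add_left measurable_const, h.ofReal_ironedCurve ht01]
  exact setLIntegral_congr_fun measurableSet_Ioc fun s hs => add_tsub_cancel_of_le (hhigh s hs)

/-- Among the densities whose tail integrals dominate the curve of the virtual valuation, the
ironed virtual valuation has the smallest truncated means. -/
theorem lintegral_ironedRate_tsub_le (h : IsDensity ρ) {f : ℝ → ℝ≥0∞}
    (hle : ∀ a ∈ Icc (0 : ℝ) 1, ENNReal.ofReal (a * (1 - distFun ρ a))
      ≤ ∫⁻ x in Icc a 1, f x ∂(valueDist ρ)) (l : ℝ≥0) :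
    ∫⁻ s in Icc (0 : ℝ) 1, (ENNReal.ofReal (ironedRate ρ s) - l)
      ≤ ∫⁻ x, (f x - l) ∂(valueDist ρ) := by
  obtain ⟨t, ht, heq⟩ := h.exists_ofReal_ironedCurve_eq l
  -- Compare at the contact point `t`, where the line built from `k` touches the envelope while the
  -- line built from `f` lies above it.
  have h1 := h.ofReal_ironedCurve_le (S := 0) (f := f) (by simpa using hle) l ht
  rw [← heq, zero_add] at h1
  exact (ENNReal.add_le_add_iff_left (by finiteness)).1 h1

/-- A density with the same truncated means as the ironed virtual valuation, whose tail integrals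
dominate the curve of the virtual valuation, is the ironed virtual valuation. -/
theorem ae_eq_ironedValue (h : IsDensity ρ) {f : ℝ → ℝ≥0∞} (hf : Measurable f)
    (hfin : ∀ᵐ x ∂(valueDist ρ), f x ≠ ⊤)
    (hle : ∀ a ∈ Icc (0 : ℝ) 1, ENNReal.ofReal (a * (1 - distFun ρ a))
      ≤ ∫⁻ x in Icc a 1, f x ∂(valueDist ρ))
    (htrunc : ∀ l : ℝ≥0, ∫⁻ x, (f x - l) ∂(valueDist ρ)
      = ∫⁻ s in Icc (0 : ℝ) 1, (ENNReal.ofReal (ironedRate ρ s) - l)) :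
    f =ᵐ[valueDist ρ] fun x => ENNReal.ofReal (ironedValue ρ x) := by
  have := h.isProbabilityMeasure
  set v := fun x => ENNReal.ofReal (ironedValue ρ x) with hv
  have hvm : AEMeasurable v (valueDist ρ) := h.aemeasurable_ofReal_ironedValue
  have hvtrunc : ∀ l : ℝ≥0, ∫⁻ x, (v x - l) ∂(valueDist ρ)
      = ∫⁻ s in Icc (0 : ℝ) 1, (ENNReal.ofReal (ironedRate ρ s) - l) := by
    intro l
    rw [← h.lintegral_distFun (h.measurable_ofReal_ironedRate.sub_const _)]
    refine lintegral_congr_ae ?_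
    filter_upwards [h.ae_ofReal_ironedValue] with x hx
    simp only [hv, hx]
  have hΨfin : ∀ l : ℝ≥0,
      ∫⁻ s in Icc (0 : ℝ) 1, (ENNReal.ofReal (ironedRate ρ s) - l) ≠ ⊤ := by
    intro l
    obtain ⟨t, -, heq⟩ := h.exists_ofReal_ironedCurve_eq l
    refine ne_top_of_le_ne_top (ENNReal.ofReal_ne_top (r := ironedCurve ρ t)) ?_
    rw [← heq]
    exact le_add_self
  -- The midpoint of the two densities again satisfies the tail bound, which is linear.
  set f₁ := fun x => 2⁻¹ * f x + 2⁻¹ * v x with hf₁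
  have hf₁m : AEMeasurable f₁ (valueDist ρ) :=
    (hf.const_mul _).aemeasurable.add (hvm.const_mul _)
  have hle₁ : ∀ a ∈ Icc (0 : ℝ) 1, ENNReal.ofReal (a * (1 - distFun ρ a))
      ≤ ∫⁻ x in Icc a 1, f₁ x ∂(valueDist ρ) := by
    intro a ha
    rw [hf₁, lintegral_add_left (hf.const_mul _), lintegral_const_mul _ hf,
      lintegral_const_mul'' _ hvm.restrict]
    calc ENNReal.ofReal (a * (1 - distFun ρ a))
        = 2⁻¹ * ENNReal.ofReal (a * (1 - distFun ρ a))
          + 2⁻¹ * ENNReal.ofReal (a * (1 - distFun ρ a)) := by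
          rw [← add_mul, ENNReal.inv_two_add_inv_two, one_mul]
      _ ≤ _ := by
          gcongr
          · exact hle a ha
          · exact h.le_setLIntegral_ironedValue ha
  have hkey : ∀ l : ℝ≥0, ∀ᵐ x ∂(valueDist ρ), f₁ x - l = 2⁻¹ * (f x - l) + 2⁻¹ * (v x - l) := by
    intro l
    have hpt : ∀ x, f₁ x - l ≤ 2⁻¹ * (f x - l) + 2⁻¹ * (v x - l) := by
      intro x
      rw [tsub_le_iff_right]
      calc f₁ x ≤ 2⁻¹ * (f x - l + l) + 2⁻¹ * (v x - l + l) := by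
            change 2⁻¹ * f x + 2⁻¹ * v x ≤ _; gcongr <;> exact le_tsub_add
        _ = 2⁻¹ * (f x - l) + 2⁻¹ * (v x - l) + (2⁻¹ + 2⁻¹) * l := by ring
        _ = _ := by rw [ENNReal.inv_two_add_inv_two, one_mul]
    have hint : ∫⁻ x, (2⁻¹ * (f x - l) + 2⁻¹ * (v x - l)) ∂(valueDist ρ)
        = ∫⁻ s in Icc (0 : ℝ) 1, (ENNReal.ofReal (ironedRate ρ s) - l) := by
      rw [lintegral_add_left ((hf.sub_const _).const_mul _),
        lintegral_const_mul _ (hf.sub_const _), lintegral_const_mul'' _ (hvm.sub_const _),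
        htrunc, hvtrunc, ← add_mul, ENNReal.inv_two_add_inv_two, one_mul]
    -- Convexity bounds the midpoint's truncated mean above by the common minimum, minimality bounds
    -- it below.
    refine ae_eq_of_ae_le_of_lintegral_le (.of_forall hpt) ?_ ?_ ?_
    · refine ne_top_of_le_ne_top (hΨfin l) ?_
      rw [← hint]
      exact lintegral_mono hpt
    · exact ((hf.sub_const _).const_mul _).aemeasurable.add ((hvm.sub_const _).const_mul _)
    · rw [hint]
      exact h.lintegral_ironedRate_tsub_le hle₁ l
  have hall : ∀ᵐ x ∂(valueDist ρ), ∀ r : ℚ, f₁ x - (Real.toNNReal r : ℝ≥0∞)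
      = 2⁻¹ * (f x - Real.toNNReal r) + 2⁻¹ * (v x - Real.toNNReal r) :=
    ae_all_iff.2 fun r => hkey _
  filter_upwards [hall, hfin] with x hx hxfin
  exact eq_of_forall_average_tsub hxfin ENNReal.ofReal_ne_top hx

/-- The solution of the dual problem is unique. -/
theorem eq_ironedMeasure_of_solvesDual (h : IsDensity ρ) {B : ℕ} (hB : 1 < B) {ς : Measure ℝ}
    (hς : SolvesDual ρ B ς) : ς = ironedMeasure ρ := by
  have hm : 0 < B - 1 := by omega
  have hfeas := hς.1
  have := hfeas.1.1
  have := h.isProbabilityMeasure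
  have := h.isProbabilityMeasure_densityLaw ς
  set q := quantileFun (densityLaw ρ ς) with hq
  have hqm : Measurable q := (monotone_quantileFun _).measurable
  -- The rearranged functional does not involve `φ`, so the bound passes to the infimum `Dual`, with
  -- no need for an optimal `φ`.
  have hle : singularMass ρ ς + ∫⁻ s in Icc (0 : ℝ) 1, q s * ENNReal.ofReal s ^ (B - 1)
      ≤ minValue ρ (B - 1) := by
    rw [← h.dualValue_ironedMeasure hB]
    exact (le_iInf₂ fun φ _ => h.rearranged_le_objective ς φ).trans
      (hς.2 _ h.isFeasible_ironedMeasure)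
  rw [rearranged_eq hm] at hle
  have hHm : Measurable fun a => singularMass ρ ς + ∫⁻ s in Icc a 1, q s := by
    refine (Antitone.measurable fun a b hab => ?_).const_add _
    exact lintegral_mono_set (Icc_subset_Icc_left hab)
  have hae : ∀ᵐ a ∂(volume.restrict (Icc (0 : ℝ) 1)),
      singularMass ρ ς + ∫⁻ s in Icc a 1, q s = ENNReal.ofReal (ironedCurve ρ a) := by
    have h1 := ae_eq_of_ae_le_of_lintegral_le (μ := volume.restrict (Icc (0 : ℝ) 1))
      (f := fun a : ℝ => ENNReal.ofReal ((B - 1 : ℕ) * a ^ (B - 1 - 1))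
        * ENNReal.ofReal (ironedCurve ρ a))
      (g := fun a : ℝ => ENNReal.ofReal ((B - 1 : ℕ) * a ^ (B - 1 - 1))
        * (singularMass ρ ς + ∫⁻ s in Icc a 1, q s)) ?_ (h.minValue_ne_top hm)
      (Measurable.mul (by fun_prop) hHm).aemeasurable hle
    · have h2 : ∀ᵐ a ∂(volume.restrict (Icc (0 : ℝ) 1)), a ∈ Ioo (0 : ℝ) 1 := by
        rw [← restrict_Ioo_eq_restrict_Icc]
        exact ae_restrict_mem measurableSet_Ioo
      filter_upwards [h1, h2] with a ha1 ha2
      -- The weight is positive on `(0,1)` and can be cancelled.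
      refine ((ENNReal.mul_right_inj ?_ ENNReal.ofReal_ne_top).1 ha1).symm
      have := ha2.1
      have hm' : (0 : ℝ) < (B - 1 : ℕ) := by exact_mod_cast hm
      exact (ENNReal.ofReal_pos.2 (by positivity)).ne'
    · filter_upwards [ae_restrict_mem measurableSet_Icc] with a ha
      gcongr
      exact h.ofReal_ironedCurve_le_quantileFun hfeas ha
  -- At almost every `a` the singular mass is at most the envelope, hence at most `1 - a`; take `a`
  -- close to `1`.
  have hS : singularMass ρ ς = 0 := by
    by_contra hS
    obtain ⟨ε, hε0, hεS⟩ := ENNReal.lt_iff_exists_nnreal_btwn.1 (pos_iff_ne_zero.2 hS)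
    have hε0' : (0 : ℝ) < ε := by exact_mod_cast hε0
    obtain ⟨a, ha, haeq⟩ := exists_mem_Ioo_of_ae hae (a := max 0 (1 - ε)) (b := 1)
      (le_max_left _ _) (max_lt one_pos (by linarith)) le_rfl
    have ha01 : a ∈ Icc (0 : ℝ) 1 := ⟨(le_max_left _ _).trans ha.1.le, ha.2.le⟩
    have h1 : singularMass ρ ς ≤ ENNReal.ofReal (ironedCurve ρ a) := haeq ▸ le_self_add
    have h2 : ENNReal.ofReal (ironedCurve ρ a) ≤ ε := by
      rw [← ENNReal.ofReal_coe_nnreal]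
      refine ENNReal.ofReal_le_ofReal ((h.ironedCurve_le_one_sub ha01).trans ?_)
      linarith [(le_max_right 0 (1 - (ε : ℝ))).trans ha.1.le]
    exact absurd hεS (not_lt.2 (h1.trans h2))
  simp only [hS, zero_add] at hae
  have hqh := h.ae_eq_ironedRate hqm
    (fun a ha => by simpa [hS] using h.ofReal_ironedCurve_le_quantileFun hfeas ha) hae
  -- Knowing `q = k` fixes the law of the density, hence all its truncated means.
  have hf := h.ae_eq_ironedValue (Measure.measurable_rnDeriv ς (valueDist ρ))
    ((Measure.rnDeriv_lt_top ς (valueDist ρ)).mono fun x hx => hx.ne)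
    (fun a ha => by simpa [hS] using h.le_add_setLIntegral_of_isFeasible hfeas ha) (by
      intro l
      rw [← lintegral_densityLaw (Φ := fun y => y - l) (by fun_prop),
        ← lintegral_quantileFun _ (by fun_prop)]
      refine lintegral_congr_ae ?_
      filter_upwards [hqh] with s hs
      rw [← hq, hs])
  have hsing : ς.singularPart (valueDist ρ) = 0 := by
    rw [← Measure.measure_univ_eq_zero, ← measure_inter_add_sdiff univ measurableSet_Icc,
      univ_inter, ← compl_eq_univ_sdiff]
    have h1 : ς.singularPart (valueDist ρ) (Icc (0 : ℝ) 1)ᶜ = 0 :=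
      le_antisymm ((Measure.singularPart_le _ _ _).trans hfeas.1.2.le) zero_le
    rw [h1, add_zero]
    exact hS
  rw [← Measure.singularPart_add_rnDeriv ς (valueDist ρ), hsing, zero_add,
    withDensity_congr_ae hf, ironedMeasure]

theorem solvesDual_iff (h : IsDensity ρ) {B : ℕ} (hB : 1 < B) (ς : Measure ℝ) :
    SolvesDual ρ B ς ↔ ς = ironedMeasure ρ :=
  ⟨h.eq_ironedMeasure_of_solvesDual hB, fun hς => hς ▸ h.solvesDual_ironedMeasure hB⟩

end IsDensity

/-! ### Recovering `φ` from its subgradients -/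

/-- `φ` has the subgradients `k s ≤ 1` at `s ^ m`, for almost every `s ∈ [0,1]`. -/
structure HasAESubgradient (m : ℕ) (k : ℝ → ℝ≥0) (φ : ℝ≥0 → ℝ≥0∞) : Prop where
  monotone : Monotone φ
  zero : φ 0 = 0
  ae : ∀ᵐ s ∂(volume.restrict (Icc (0 : ℝ) 1)), IsSubgradient φ (s.toNNReal ^ m) (k s)

namespace HasAESubgradient

variable {m : ℕ} {k : ℝ → ℝ≥0} {φ φ' : ℝ≥0 → ℝ≥0∞}

/-- Some point to the right of `t` carries a subgradient, so `φ` is finite there, and `φ` is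
monotone. -/
theorem ne_top (h : HasAESubgradient m k φ) {t : ℝ} (ht0 : 0 ≤ t) (ht : t < 1) :
    φ (t.toNNReal ^ m) ≠ ⊤ := by
  obtain ⟨s, hs, hsub⟩ := exists_mem_Ioo_of_ae h.ae ht0 ht le_rfl
  exact ne_top_of_le_ne_top hsub.1
    (h.monotone (pow_le_pow_left' (Real.toNNReal_le_toNNReal hs.1.le) m))

theorem toReal_le_of_isSubgradient {w y z : ℝ≥0} (hsub : IsSubgradient φ w y) (hz : φ z ≠ ⊤) :
    (φ w).toReal + y * (z - w) ≤ (φ z).toReal := by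
  have h1 := hsub.2 z
  have h2 := hsub.1
  have h3 := ENNReal.toReal_mono (by finiteness) h1
  rw [ENNReal.toReal_add h2 (by finiteness), ENNReal.toReal_add hz (by finiteness)] at h3
  simp only [ENNReal.toReal_mul, ENNReal.coe_toReal] at h3
  linarith

/-- A subgradient at `r^m`, `r > t`, bounds the increment from `s^m` to `r^m` by `r^m - s^m`, since
it is at most one. Such `r` exist arbitrarily close to `t`. -/
theorem toReal_sub_le (h : HasAESubgradient m k φ) (hk : ∀ s, k s ≤ 1) {s t : ℝ} (hs : 0 ≤ s)
    (hst : s ≤ t) (ht : t < 1) :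
    (φ (t.toNNReal ^ m)).toReal - (φ (s.toNNReal ^ m)).toReal ≤ t ^ m - s ^ m := by
  have ht0 := hs.trans hst
  have hcont : Tendsto (fun r : ℝ => r ^ m - s ^ m) (𝓝[>] t) (𝓝 (t ^ m - s ^ m)) :=
    ((continuous_id.pow m).sub continuous_const).continuousAt.tendsto.mono_left nhdsWithin_le_nhds
  refine le_of_forall_pos_le_add fun ε hε => ?_
  have hev := hcont.eventually_lt_const (lt_add_of_pos_right (t ^ m - s ^ m) hε)
  obtain ⟨b, hb, hsub⟩ := (mem_nhdsGT_iff_exists_Ioo_subset' ht).1 hev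
  obtain ⟨r, hr, hsubr⟩ := exists_mem_Ioo_of_ae h.ae ht0 (lt_min hb ht) (min_le_right _ _)
  have hr1 : r < 1 := hr.2.trans_le (min_le_right _ _)
  have hr2 : r ^ m - s ^ m < t ^ m - s ^ m + ε := hsub ⟨hr.1, hr.2.trans_le (min_le_left _ _)⟩
  have h1 : (φ (t.toNNReal ^ m)).toReal ≤ (φ (r.toNNReal ^ m)).toReal :=
    ENNReal.toReal_mono (h.ne_top (ht0.trans hr.1.le) hr1)
      (h.monotone (pow_le_pow_left' (Real.toNNReal_le_toNNReal hr.1.le) m))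
  have h2 := toReal_le_of_isSubgradient hsubr (h.ne_top hs (hst.trans_lt ht))
  push_cast at h2
  rw [Real.coe_toNNReal _ hs, Real.coe_toNNReal _ (ht0.trans hr.1.le)] at h2
  have h3 : (k r : ℝ) ≤ 1 := hk r
  have h4 : 0 ≤ r ^ m - s ^ m := sub_nonneg.2 (pow_le_pow_left₀ hs (hst.trans hr.1.le) m)
  nlinarith

theorem lipschitzOnWith (h : HasAESubgradient m k φ) (hk : ∀ s, k s ≤ 1) {c : ℝ} (hc : c < 1) :
    LipschitzOnWith m (fun t : ℝ => (φ (t.toNNReal ^ m)).toReal) (Icc 0 c) := by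
  have hpow : LipschitzOnWith m (fun t : ℝ => t ^ m) (Icc 0 c) := by
    refine Convex.lipschitzOnWith_of_nnnorm_deriv_le (fun x _ => by fun_prop) (fun x hx => ?_)
      (convex_Icc 0 c)
    rw [← NNReal.coe_le_coe, coe_nnnorm, deriv_pow_field, Real.norm_eq_abs, abs_of_nonneg
      (mul_nonneg (Nat.cast_nonneg _) (pow_nonneg hx.1 _))]
    exact mul_le_of_le_one_right (Nat.cast_nonneg _) (pow_le_one₀ hx.1 (hx.2.trans hc.le))
  refine LipschitzOnWith.of_dist_le_mul fun s hs t ht => ?_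
  refine le_trans ?_ (hpow.dist_le_mul s hs t ht)
  wlog hst : s ≤ t generalizing s t
  · rw [dist_comm, dist_comm (s ^ m)]
    exact this t ht s hs (le_of_not_ge hst)
  have ht1 := ht.2.trans_lt hc
  have h1 := h.toReal_sub_le hk hs.1 hst ht1
  have h2 : (φ (s.toNNReal ^ m)).toReal ≤ (φ (t.toNNReal ^ m)).toReal :=
    ENNReal.toReal_mono (h.ne_top ht.1 ht1)
      (h.monotone (pow_le_pow_left' (Real.toNNReal_le_toNNReal hst) m))
  have h3 := pow_le_pow_left₀ hs.1 hst m
  rw [Real.dist_eq, Real.dist_eq, abs_of_nonpos (by linarith), abs_of_nonpos (by linarith)]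
  linarith

/-- Where `φ(s^m)` is differentiable and `k(t)` is a subgradient, `φ(s^m) - k(t) s^m` has a local
minimum at `t`, so its derivative vanishes. -/
theorem ae_hasDerivAt (h : HasAESubgradient m k φ) (hk : ∀ s, k s ≤ 1) {c : ℝ} (hc : c < 1) :
    ∀ᵐ t : ℝ, t ∈ Ioo 0 c → HasDerivAt (fun t : ℝ => (φ (t.toNNReal ^ m)).toReal)
      (k t * (m * t ^ (m - 1))) t := by
  have h1 := (h.lipschitzOnWith hk hc).ae_differentiableWithinAt_real measurableSet_Icc
  rw [ae_restrict_iff' measurableSet_Icc] at h1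
  filter_upwards [h1, (ae_restrict_iff' measurableSet_Icc).1 h.ae] with t ht1 ht2 ht
  have hd := ((ht1 (Ioo_subset_Icc_self ht)).differentiableAt
    (Icc_mem_nhds ht.1 ht.2)).hasDerivAt
  have hsub := ht2 ⟨ht.1.le, ht.2.le.trans hc.le⟩
  have hp : HasDerivAt (fun s : ℝ => (k t : ℝ) * s ^ m) (k t * (m * t ^ (m - 1))) t :=
    (hasDerivAt_pow m t).const_mul _
  have hmin : IsLocalMin (fun s : ℝ => (φ (s.toNNReal ^ m)).toReal - k t * s ^ m) t := by
    filter_upwards [Ioo_mem_nhds ht.1 ht.2] with s hs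
    have h3 := toReal_le_of_isSubgradient hsub (h.ne_top hs.1.le (hs.2.trans hc))
    push_cast at h3
    rw [Real.coe_toNNReal _ hs.1.le, Real.coe_toNNReal _ ht.1.le] at h3
    linarith
  have h4 := hmin.hasDerivAt_eq_zero (hd.sub hp)
  rwa [sub_eq_zero.1 h4] at hd

/-- The subgradients determine `φ` on `[0,1)`. -/
theorem eq_of_lt_one (h : HasAESubgradient m k φ) (h' : HasAESubgradient m k φ') (hm : 0 < m)
    (hk : ∀ s, k s ≤ 1) {z : ℝ≥0} (hz : z < 1) : φ z = φ' z := by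
  obtain ⟨t, ht0, rfl⟩ : ∃ t : ℝ, 0 ≤ t ∧ t.toNNReal ^ m = z :=
    ⟨((z ^ ((m : ℝ)⁻¹) : ℝ≥0) : ℝ), NNReal.coe_nonneg _, by
      rw [Real.toNNReal_coe, NNReal.rpow_inv_natCast_pow z hm.ne']⟩
  have ht1 : t < 1 := by
    by_contra hc
    exact absurd hz (not_lt.2 (one_le_pow_of_one_le' (Real.one_le_toNNReal.2 (not_lt.1 hc)) m))
  have hlip := (h.lipschitzOnWith hk ht1)
  have hlip' := (h'.lipschitzOnWith hk ht1)
  rw [← uIcc_of_le ht0] at hlip hlip'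
  -- The difference is absolutely continuous with derivative zero almost everywhere, hence constant.
  have hac := hlip.absolutelyContinuousOnInterval.sub hlip'.absolutelyContinuousOnInterval
  obtain ⟨C, hC⟩ := hac.const_of_ae_hasDerivAt_zero (by
    have hne : ∀ᵐ s : ℝ, s ≠ 0 ∧ s ≠ t :=
      (Measure.ae_ne volume 0).and (Measure.ae_ne volume t)
    filter_upwards [h.ae_hasDerivAt hk ht1, h'.ae_hasDerivAt hk ht1, hne] with s h1 h2 h3 hs
    rw [uIcc_of_le ht0] at hs
    have hs' : s ∈ Ioo 0 t := ⟨hs.1.lt_of_ne h3.1.symm, hs.2.lt_of_ne h3.2⟩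
    simpa using (h1 hs').sub (h2 hs'))
  have h1 := hC 0 left_mem_uIcc
  have h2 := hC t right_mem_uIcc
  simp only [Pi.sub_apply, Real.toNNReal_zero, zero_pow hm.ne', h.zero, h'.zero, sub_self] at h1 h2
  rw [← h1, sub_eq_zero] at h2
  exact (ENNReal.toReal_eq_toReal_iff' (h.ne_top ht0 ht1) (h'.ne_top ht0 ht1)).1 h2

end HasAESubgradient

/-- A monotone lower semicontinuous function is determined at `1` by its values on `[0,1)`. -/
theorem le_of_lowerSemicontinuous {φ φ' : ℝ≥0 → ℝ≥0∞} (hφ : LowerSemicontinuous φ)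
    (hφ' : Monotone φ') (heq : ∀ z : ℝ≥0, z < 1 → φ z = φ' z) : φ 1 ≤ φ' 1 := by
  by_contra hc
  have h1 : ∀ᶠ z in 𝓝 (1 : ℝ≥0), φ' 1 < φ z := hφ 1 _ (not_le.1 hc)
  have : (𝓝[<] (1 : ℝ≥0)).NeBot := nhdsLT_neBot_of_exists_lt ⟨0, one_pos⟩
  obtain ⟨z, hz1, hz2⟩ :=
    ((h1.filter_mono nhdsWithin_le_nhds).and (self_mem_nhdsWithin : Iio (1 : ℝ≥0) ∈ _)).exists
  rw [heq z hz2] at hz1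
  exact absurd (hφ' (le_of_lt hz2)) (not_le.2 hz1)

/-! ### Optimal pairs -/

namespace IsDensity

variable {ρ : ℝ → ℝ}

/-- Since `minValue` is attained, a pair is optimal exactly when its objective equals it. Then
`Dual` is minimal as well, which identifies the measure, and Young's equality gives the rest. -/
theorem isOptimalPair_iff (h : IsDensity ρ) {B : ℕ} (hB : 1 < B) (ς : Measure ℝ)
    (φ : ℝ≥0 → ℝ≥0∞) : IsOptimalPair ρ B ς φ ↔ ς = ironedMeasure ρ ∧ IsAdmissible φ ∧
      ∀ᵐ s ∂(volume.restrict (Icc (0 : ℝ) 1)),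
        IsSubgradient φ (s.toNNReal ^ (B - 1)) (ironedRate ρ s).toNNReal := by
  constructor
  · rintro ⟨hς, hφ, hopt⟩
    have hle : objective ρ B ς φ ≤ minValue ρ (B - 1) := by
      rw [← h.objective_optimal hB]
      exact hopt _ _ h.isFeasible_ironedMeasure (isAdmissible_optimalPhi _ _)
    have heq : ς = ironedMeasure ρ := h.eq_ironedMeasure_of_solvesDual hB
      ⟨hς, fun ς' hς' => (iInf₂_le φ hφ).trans (hle.trans (h.minValue_le_dualValue hB hς'))⟩
    refine ⟨heq, hφ, (h.objective_le_minValue_iff hB hφ).1 ?_⟩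
    rwa [← heq]
  · rintro ⟨rfl, hφ, hsub⟩
    exact ⟨h.isFeasible_ironedMeasure, hφ, fun ς' φ' hς' _ =>
      ((h.objective_le_minValue_iff hB hφ).2 hsub).trans (h.minValue_le_objective hB hς' φ')⟩

theorem ae_isSubgradient_iff (h : IsDensity ρ) {m : ℕ} {φ : ℝ≥0 → ℝ≥0∞} (hφ : IsAdmissible φ) :
    (∀ᵐ s ∂(volume.restrict (Icc (0 : ℝ) 1)),
        IsSubgradient φ (s.toNNReal ^ m) (ironedRate ρ s).toNNReal) ↔
      ∀ᵐ x ∂(valueDist ρ),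
        IsSubgradient φ ((distFun ρ x).toNNReal ^ m) (ironedValue ρ x).toNNReal := by
  -- Transport along `P` as an equivalence needs a measurable set; Young's equality exhibits it as
  -- one.
  have hmeas : MeasurableSet
      {s : ℝ | IsSubgradient φ (s.toNNReal ^ m) (ironedRate ρ s).toNNReal} := by
    simp_rw [← legendre_add_eq_iff hφ.zero]
    have hr := h.monotone_ironedRate.measurable
    have hL := (monotone_legendre φ).measurable
    have hφm := hφ.monotone.measurable
    refine measurableSet_eq_fun (Measurable.add (hL.comp ?_) (hφm.comp ?_)) ?_ <;> fun_prop
  rw [← h.map_distFun, ae_map_iff h.aemeasurable_distFun hmeas]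
  have hcongr : ∀ᵐ x ∂(valueDist ρ), ironedValue ρ x = ironedRate ρ (distFun ρ x) :=
    h.ae_ironedValue.mono fun x hx => hx.2
  constructor <;> intro hs <;> filter_upwards [hs, hcongr] with x hx1 hx2
  · rwa [hx2]
  · rwa [hx2] at hx1

theorem eq_of_isOptimalPair (h : IsDensity ρ) {B : ℕ} (hB : 1 < B) {ς ς' : Measure ℝ}
    {φ φ' : ℝ≥0 → ℝ≥0∞} (hp : IsOptimalPair ρ B ς φ) (hp' : IsOptimalPair ρ B ς' φ') {z : ℝ≥0}
    (hz : z < 1) : φ z = φ' z := by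
  obtain ⟨-, hφ, hsub⟩ := (h.isOptimalPair_iff hB _ _).1 hp
  obtain ⟨-, hφ', hsub'⟩ := (h.isOptimalPair_iff hB _ _).1 hp'
  exact HasAESubgradient.eq_of_lt_one ⟨hφ.monotone, hφ.zero, hsub⟩
    ⟨hφ'.monotone, hφ'.zero, hsub'⟩ (by omega)
    (fun s => Real.toNNReal_le_one.2 (h.ironedRate_mem s).2) hz

theorem isOptimalPair_optimalPhi (h : IsDensity ρ) {B : ℕ} (hB : 1 < B) :
    IsOptimalPair ρ B (ironedMeasure ρ) (optimalPhi ρ (B - 1)) := by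
  refine (h.isOptimalPair_iff hB _ _).2 ⟨rfl, isAdmissible_optimalPhi _ _, ?_⟩
  filter_upwards [ae_restrict_mem measurableSet_Icc] with s hs
  exact h.isSubgradient_optimalPhi (by omega) hs

/-- A measure on the unit interval is the ironed measure if and only if its curve is the curve of
the ironed virtual valuation. -/
theorem measureCurve_eq_iff (h : IsDensity ρ) {ς : Measure ℝ} (hς : IsMeasureOnUnit ς) :
    (∀ t ∈ Icc (0 : ℝ) 1, measureCurve ρ ς t = curve ρ (ironedValue ρ) t) ↔
      ς = ironedMeasure ρ := by
  have hς₀ := h.isMeasureOnUnit_ironedMeasure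
  have := hς.1
  have := hς₀.1
  constructor
  · intro hcurve
    have hIcc : ∀ a ∈ Icc (0 : ℝ) 1, ς (Icc a 1) = ironedMeasure ρ (Icc a 1) := by
      intro a ha
      have h1 := hcurve _ (h.distFun_mem ha)
      rw [measureCurve, h.quantile_distFun ha, ← h.ironedCurve_eq_curve (h.distFun_mem ha)] at h1
      rw [h.ironedMeasure_Icc ha, ← h1, ofReal_measureReal]
    -- Finite measures are determined by half-lines, and for measures on the unit interval these
    -- reduce to the tails `[a,1]`.
    refine Measure.ext_of_Ici _ _ fun a => ?_
    have hinter : ∀ ν : Measure ℝ, ν (Icc 0 1)ᶜ = 0 → ν (Ici a) = ν (Icc (max a 0) 1) := by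
      intro ν hν
      rw [← measure_inter_add_sdiff (Ici a) measurableSet_Icc,
        measure_mono_null (fun x hx => hx.2 : Ici a \ Icc 0 1 ⊆ (Icc (0 : ℝ) 1)ᶜ) hν, add_zero]
      congr 1
      ext x
      simp [and_assoc]
    rw [hinter _ hς.2, hinter _ hς₀.2]
    rcases le_or_gt a 1 with ha | ha
    · exact hIcc _ ⟨le_max_right _ _, max_le ha zero_le_one⟩
    · simp [Icc_eq_empty (not_le.2 (lt_max_of_lt_left ha : 1 < max a 0))]
  · rintro rfl t ht
    rw [measureCurve, Measure.real, h.ironedMeasure_Icc (h.quantile_mem ht),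
      h.distFun_quantile ht, ENNReal.toReal_ofReal (h.isMajorant_ironedCurve.nonneg t ht),
      h.ironedCurve_eq_curve ht]

end IsDensity

end OneItem

theorem proposition3 (ρ : ℝ → ℝ) (hρ : ContDiffOn ℝ 1 ρ (Set.Icc 0 1))
    (hpos : ∀ x ∈ Set.Icc (0 : ℝ) 1, 0 < ρ x) (hone : ∫ x in (0 : ℝ)..1, ρ x = 1)
    (B : ℕ) (hB : 1 < B) :
    -- the infimum defining the envelope is the least majorant of `G_V`, the ironed virtual valuation
    -- is well defined almost everywhere and non-negative, and the envelope is its tail integral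
    (OneItem.IsMajorant (OneItem.curve ρ (OneItem.virtualValue ρ)) (OneItem.ironedCurve ρ) ∧
      (∀ᵐ x ∂(OneItem.valueDist ρ),
        DifferentiableAt ℝ (OneItem.ironedCurve ρ) (OneItem.distFun ρ x) ∧
          0 ≤ OneItem.ironedValue ρ x) ∧
      ∀ t ∈ Set.Icc (0 : ℝ) 1,
        OneItem.ironedCurve ρ t = OneItem.curve ρ (OneItem.ironedValue ρ) t) ∧
    -- characterizations of the solutions of the dual problem
    (∀ ς : MeasureTheory.Measure ℝ, OneItem.IsMeasureOnUnit ς →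
      ((OneItem.SolvesDual ρ B ς ↔ ∀ t ∈ Set.Icc (0 : ℝ) 1,
          OneItem.measureCurve ρ ς t = OneItem.curve ρ (OneItem.ironedValue ρ) t) ∧
        (OneItem.SolvesDual ρ B ς ↔ ς = (OneItem.valueDist ρ).withDensity
          fun x => ENNReal.ofReal (OneItem.ironedValue ρ x)))) ∧
    -- existence and uniqueness; no singular part; the field is the ironed virtual valuation
    (∃! ς : MeasureTheory.Measure ℝ, OneItem.SolvesDual ρ B ς) ∧
    (∀ ς : MeasureTheory.Measure ℝ, OneItem.SolvesDual ρ B ς →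
      ς.singularPart (OneItem.valueDist ρ) = 0 ∧
        ∀ᵐ x ∂(OneItem.valueDist ρ),
          ς.rnDeriv (OneItem.valueDist ρ) x = ENNReal.ofReal (OneItem.ironedValue ρ x)) ∧
    -- the optimal pairs, with `φ` given by its subgradients
    (∀ (ς : MeasureTheory.Measure ℝ) (φ : ℝ≥0 → ℝ≥0∞),
      OneItem.IsOptimalPair ρ B ς φ ↔
        OneItem.SolvesDual ρ B ς ∧ OneItem.IsAdmissible φ ∧
          ∀ᵐ x ∂(OneItem.valueDist ρ),
            OneItem.IsSubgradient φ ((OneItem.distFun ρ x).toNNReal ^ (B - 1))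
              (OneItem.ironedValue ρ x).toNNReal) ∧
    -- uniqueness of the optimal `φ` on `[0,1)`
    (∀ (ς ς' : MeasureTheory.Measure ℝ) (φ φ' : ℝ≥0 → ℝ≥0∞),
      OneItem.IsOptimalPair ρ B ς φ → OneItem.IsOptimalPair ρ B ς' φ' →
        ∀ z : ℝ≥0, z < 1 → φ z = φ' z) ∧
    -- existence, and uniqueness everywhere once `φ` is normalized as a function on `[0,1]`
    (∃! p : MeasureTheory.Measure ℝ × (ℝ≥0 → ℝ≥0∞),
      OneItem.IsOptimalPair ρ B p.1 p.2 ∧ LowerSemicontinuous p.2 ∧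
        ∀ z : ℝ≥0, 1 < z → p.2 z = ⊤) := by
  have h : OneItem.IsDensity ρ := ⟨hρ.continuousOn, hpos, hone⟩
  refine ⟨⟨h.isMajorant_ironedCurve, ?_, fun t ht => h.ironedCurve_eq_curve ht⟩,
    fun ς hς => ⟨?_, h.solvesDual_iff hB ς⟩, ?_, ?_, ?_,
    fun ς ς' φ φ' hp hp' z hz => h.eq_of_isOptimalPair hB hp hp' hz, ?_⟩
  · filter_upwards [h.ae_ironedValue] with x hx
    exact ⟨hx.1, hx.2 ▸ (h.ironedRate_mem _).1⟩
  · rw [h.solvesDual_iff hB, h.measureCurve_eq_iff hς]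
  · exact ⟨OneItem.ironedMeasure ρ, h.solvesDual_ironedMeasure hB,
      fun ς hς => h.eq_ironedMeasure_of_solvesDual hB hς⟩
  · intro ς hς
    rw [h.eq_ironedMeasure_of_solvesDual hB hς]
    exact ⟨Measure.singularPart_withDensity _ _, h.rnDeriv_ironedMeasure⟩
  · intro ς φ
    rw [h.isOptimalPair_iff hB, h.solvesDual_iff hB]
    exact and_congr_right fun _ => and_congr_right fun hφ => h.ae_isSubgradient_iff hφ
  · refine ⟨(OneItem.ironedMeasure ρ, OneItem.optimalPhi ρ (B - 1)),
      ⟨h.isOptimalPair_optimalPhi hB, OneItem.lowerSemicontinuous_legendre _, fun z hz =>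
        OneItem.legendre_eq_top (OneItem.optimalConjugate_le ρ (by omega)) hz⟩, ?_⟩
    rintro ⟨ς, φ⟩ ⟨hp, hlsc, htop⟩
    have hp₀ := h.isOptimalPair_optimalPhi hB
    have heq : ∀ z : ℝ≥0, z < 1 → φ z = OneItem.optimalPhi ρ (B - 1) z :=
      fun z hz => h.eq_of_isOptimalPair hB hp hp₀ hz
    refine Prod.ext ((h.isOptimalPair_iff hB _ _).1 hp).1 (funext fun z => ?_)
    -- The subgradients decide below `1`, lower semicontinuity with monotonicity at `1`, and the
    -- normalization above.
    rcases lt_trichotomy z 1 with hz | rfl | hz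
    · exact heq z hz
    · exact le_antisymm (OneItem.le_of_lowerSemicontinuous hlsc hp₀.2.1.monotone heq)
        (OneItem.le_of_lowerSemicontinuous (OneItem.lowerSemicontinuous_legendre _)
          hp.2.1.monotone fun z hz => (heq z hz).symm)
    · exact (htop z hz).trans
        (OneItem.legendre_eq_top (OneItem.optimalConjugate_le ρ (by omega)) hz).symm
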